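/- Let $r\ge 0$, $0\le k\le N$ be integers, $z_1,\dots,z_k\in\mathbb C$ pairwise distinct, $u_{k+1},\dots,u_N\in\mathbb C$ pairwise distinct, and $w\in\mathbb C$. For $1\le i\le N$ let $X_i$ be the $r\times r$ matrix of coordinate functions on the $i$-th factor of $\mathfrak{gl}(r,\mathbb C)^N$, and equip the algebra $\mathcal S$ of complex polynomial functions on $\mathfrak{gl}(r,\mathbb C)^N$ with the product Lie--Poisson bracket $\{F,G\}=\sum_{i=1}^N \operatorname{Tr}\bigl(\nabla_iF\,[X_i,\nabla_iG]\bigr)$, where $(\nabla_iF)_{ba}=\partial F/\partial (X_i)_{ab}$. For a rational matrix function $L(z)$ with coefficients in $\mathcal S$ and a finite set $P\subset\mathbb C$ of poles, the spectral invariants of $L$ are the elements $$\operatorname*{Res}_{z=p}\,(z-p)^{l}\,\operatorname{Tr}\bigl(L(z)^{\alpha}\bigr),\qquad p\in P,\quad 1\le\alpha\le r,\quad 0\le l\le\alpha-1,$$ of $\mathcal S$. Let $\mathcal H^{(1)}$ and $\mathcal H^{(2)}$ be the sets of spectral invariants of $$L_1(z)=\sum_{i=k+1}^N\frac{X_i}{z-u_i}\quad\text{and}\quad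 L_2(z)=\sum_{i=1}^k\frac{X_i}{z-z_i}+\frac{\sum_{i=k+1}^N X_i}{z-w},$$ with pole sets $\{u_{k+1},\dots,u_N\}$ and $\{z_1,\dots,z_k,w\}$ respectively, and let $\mathcal H_{1,2,w}\subset\mathcal S$ be the $\mathbb C$-subalgebra generated by $\mathcal H^{(1)}\cup\mathcal H^{(2)}$. Then: 1. Any two elements of $\mathcal H^{(1)}\cup\mathcal H^{(2)}$ Poisson-commute, and consequently so do any two elements of $\mathcal H_{1,2,w}$. If moreover $w\notin\{z_1,\dots,z_k\}$, then: 2. For all pairwise distinct $\zeta_1,\dots,\zeta_N\in\mathbb C$, the transcendence degree over $\mathbb C$ of $\mathcal H_{1,2,w}$ equals that of the $\mathbb C$-subalgebra of $\mathcal S$ generated by the spectral invariants of the Gaudin Lax matrix $L_G(z)=\sum_{i=1}^N\frac{X_i}{z-\zeta_i}$ (with pole set $\{\zeta_1,\dots,\zeta_N\}$). 3. The Hamiltonian $H_G=\frac12\sum_{i\ne j}\operatorname{Tr}(X_iX_j)$ lies in $\mathcal H_{1,2,w}$. -/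

import Mathlib

namespace Gaudin

/-- The algebra of polynomial functions on the phase space `gl(r, ℂ)^N` (identified with its dual
through the trace form), tensored with a coefficient ring `R`: the variable `(i, a, b)` is the
`(a, b)` entry of the matrix `X_i` at the `i`-th site. -/
abbrev Fun (R : Type) [CommRing R] (N r : ℕ) : Type :=
  MvPolynomial (Fin N × Fin r × Fin r) R

/-- The matrix `X_i` of coordinate functions at the `i`-th site. -/
noncomputable def site (R : Type) [CommRing R] {N r : ℕ} (i : Fin N) :
    Matrix (Fin r) (Fin r) (Fun R N r) :=
  Matrix.of fun a b => MvPolynomial.X (i, a, b)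

/-- The gradient `∇_i F` with respect to `X_i` for the trace form: `dF = ∑ i, Tr (∇_i F * dX_i)`,
that is `(∇_i F)_{ba} = ∂F / ∂(X_i)_{ab}`. -/
noncomputable def grad {N r : ℕ} (i : Fin N) (F : Fun ℂ N r) :
    Matrix (Fin r) (Fin r) (Fun ℂ N r) :=
  Matrix.of fun b a => MvPolynomial.pderiv (i, a, b) F

/-- The standard (product Lie--Poisson) bracket on `gl(r, ℂ)^N`:
`{F, G} = ∑ i, Tr (∇_i F * [X_i, ∇_i G])`. -/
noncomputable def bracket {N r : ℕ} (F G : Fun ℂ N r) : Fun ℂ N r :=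
  ∑ i, Matrix.trace (grad i F * (site ℂ i * grad i G - grad i G * site ℂ i))

/-- The rational function `1 / (z - a)` of the spectral parameter `z`. -/
noncomputable def invSub (a : ℂ) : RatFunc ℂ :=
  1 / (RatFunc.X - RatFunc.C a)

/-- The Gaudin Lax matrix `L_G(z) = ∑ i, X_i / (z - z_i)`, a matrix of polynomial functions on the
phase space with coefficients in the field `ℂ(z)`. -/
noncomputable def lax {N r : ℕ} (z : Fin N → ℂ) : Matrix (Fin r) (Fin r) (Fun (RatFunc ℂ) N r) :=
  ∑ i, invSub (z i) • site (RatFunc ℂ) i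

/-- The first limiting Lax matrix `L_1(z) = ∑_{i > k} X_i / (z - u_i)`, for `N = k + m` sites. -/
noncomputable def lax₁ {k m r : ℕ} (u : Fin m → ℂ) :
    Matrix (Fin r) (Fin r) (Fun (RatFunc ℂ) (k + m) r) :=
  ∑ j, invSub (u j) • site (RatFunc ℂ) (Fin.natAdd k j)

/-- The second limiting Lax matrix
`L_2(z) = ∑_{i ≤ k} X_i / (z - z_i) + (∑_{i > k} X_i) / (z - w)`, for `N = k + m` sites. -/
noncomputable def lax₂ {k m r : ℕ} (z : Fin k → ℂ) (w : ℂ) :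
    Matrix (Fin r) (Fin r) (Fun (RatFunc ℂ) (k + m) r) :=
  ∑ i, invSub (z i) • site (RatFunc ℂ) (Fin.castAdd m i) +
    invSub w • ∑ j : Fin m, site (RatFunc ℂ) (Fin.natAdd k j)

/-- The residue at `z = p` of a rational function `f(z)`: the coefficient of `t⁻¹` in the Laurent
expansion of `f(p + t)` at `t = 0`. -/
noncomputable def residue (p : ℂ) (f : RatFunc ℂ) : ℂ :=
  ((RatFunc.laurent p f : RatFunc ℂ) : LaurentSeries ℂ).coeff (-1)

/-- The residue at `z = p` of a rational function of `z` whose values are polynomial functions on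
the phase space, taken monomial by monomial. -/
noncomputable def residueFun {N r : ℕ} (p : ℂ) (F : Fun (RatFunc ℂ) N r) : Fun ℂ N r :=
  ∑ d ∈ F.support, MvPolynomial.monomial d (residue p (F.coeff d))

/-- The spectral invariants `Res_{z = p} (z - p)^l Tr (L(z)^α)` of a Lax matrix `L` with set of
poles `P`, where `p ∈ P`, `1 ≤ α ≤ r` and `0 ≤ l ≤ α - 1`. -/
def spectralInvariants {N r : ℕ} (L : Matrix (Fin r) (Fin r) (Fun (RatFunc ℂ) N r)) (P : Set ℂ) :
    Set (Fun ℂ N r) :=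
  {h | ∃ p ∈ P, ∃ α ∈ Finset.Icc 1 r, ∃ l < α,
    h = residueFun p (MvPolynomial.C ((RatFunc.X - RatFunc.C p) ^ l) * Matrix.trace (L ^ α))}

/-- The spectral invariants of the Gaudin Lax matrix with poles `z_1, …, z_N`. -/
def spec {N r : ℕ} (z : Fin N → ℂ) : Set (Fun ℂ N r) :=
  spectralInvariants (lax z) (Set.range z)

/-- The spectral invariants of `L_1`. -/
def spec₁ {k m r : ℕ} (u : Fin m → ℂ) : Set (Fun ℂ (k + m) r) :=
  spectralInvariants (lax₁ u) (Set.range u)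

/-- The spectral invariants of `L_2`. -/
def spec₂ {k m r : ℕ} (z : Fin k → ℂ) (w : ℂ) : Set (Fun ℂ (k + m) r) :=
  spectralInvariants (lax₂ z w) (insert w (Set.range z))

/-- The algebra generated by the spectral invariants of `L_1` and `L_2`. -/
noncomputable def limitAlgebra {k m r : ℕ} (z : Fin k → ℂ) (u : Fin m → ℂ) (w : ℂ) :
    Subalgebra ℂ (Fun ℂ (k + m) r) :=
  Algebra.adjoin ℂ (spec₁ u ∪ spec₂ z w)

/-- The physical Hamiltonian `H_G = (1/2) ∑_{i ≠ j} Tr (X_i X_j)`. -/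
noncomputable def physicalHamiltonian (N r : ℕ) : Fun ℂ N r :=
  (1 / 2 : ℂ) • ∑ i : Fin N, ∑ j ∈ Finset.univ.erase i, Matrix.trace (site ℂ i * site ℂ j)

end Gaudin

/-!
# Limits of Gaudin integrable systems

Everything is reduced to the values `Tr (L(x) ^ a)` of a Lax matrix `L(z) = ∑ i, Y_i / (z - ν_i)`
at regular points `x`. The numerator of `Tr (L(z) ^ a)` is a polynomial in `z` of degree less than
`a` times the number of nodes, so it is determined by its values at infinitely many points, and,
when the nodes are distinct, by its residues (partial fractions). By duality of vector spaces this
scalar statement carries over to coefficients in polynomial functions on the phase space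
(`coeffwise_mem`). Hence spectral invariants are linear combinations of values
(`spectralInvariants_subset_span`), and for distinct nodes both families generate the same algebra
(`adjoin_spectralInvariants`).

*Commutation.* A value of either limiting Lax matrix has the form `∑ i, c_i X_i` with complex
`c_i`. The bracket of `Tr (∑ i, c_i X_i) ^ a` and `Tr (∑ i, c'_i X_i) ^ b` vanishes as soon as
`∑ i, c_i c'_i X_i` is a combination of the two matrices (`bracket_trace_pow_eq_zero`). For one Lax
matrix at two points this is the identity `1/((x-p)(y-p)) = (1/(x-p) - 1/(y-p))/(y-x)`; for `L_1`
against `L_2` it holds because `L_2` weights all the sites `i > k` equally.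

*Transcendence degree.* Clearing denominators and choosing a suitable coordinate for `z`, the
algebras are generated by the coefficients of `Tr (B_c(t) ^ a)` for one (Gaudin) or two (limit)
matrix polynomials `B_c`, the arms, of degrees `k_c`. The arms share their constant term, and their
coefficients are, up to a linear change of variables, independent generic matrices: for the limit,
the common term is the residue `X_{k+1} + ⋯ + X_N` of `L_2` at `w`, which is also the leading term
of `L_1` at infinity. The coefficients of degree at most `k_c a` (with the
common ones of degree `0` counted once) are algebraically independent
(`algebraicIndependent_gen`), so the transcendence degree only depends on `r` and the total degree
`∑ c, k_c`, which is `N - 1` in both cases. Independence follows from the Jacobian criterion at the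
point where each arm is `E + t ^ k_c D`, with `E` the nilpotent shift and `D = diag(1, 2, 4, …)`:
since `D E = 2 E D`, the entries of the powers of this matrix are Gaussian binomial coefficients
times powers of `2`, and the differentials are independent by a Vandermonde argument.

*Hamiltonian.* The residues `Y_i` and their sum are limits of multiples of values of `L(x)`, so
`Tr (Y_i ^ 2)` and `Tr ((∑ i, Y_i) ^ 2)` lie in the algebra, and `H_G` is a combination of these.
-/

namespace Gaudin

/-! ### Linear maps applied to coefficients -/

section Coeffwise

open MvPolynomial

variable {σ A B : Type*} [CommRing A] [Algebra ℂ A] [CommRing B] [Algebra ℂ B]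

/-- A linear map between coefficient rings, applied to each coefficient of a multivariate
polynomial. It covers residues (coefficients in `ℂ(z)`), evaluations at a value of the spectral
parameter and extraction of a power of it (coefficients in `ℂ[z]`). -/
noncomputable def coeffwise (ρ : A →ₗ[ℂ] B) (q : MvPolynomial σ A) : MvPolynomial σ B :=
  ∑ d ∈ q.support, monomial d (ρ (q.coeff d))

@[simp] theorem coeff_coeffwise (ρ : A →ₗ[ℂ] B) (q : MvPolynomial σ A) (d : σ →₀ ℕ) :
    (coeffwise ρ q).coeff d = ρ (q.coeff d) := by
  classical
  rw [coeffwise, coeff_sum]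
  simp only [coeff_monomial, Finset.sum_ite_eq']
  split_ifs with h
  · rfl
  · rw [notMem_support_iff.1 h, map_zero]

theorem map_eq_coeffwise (φ : A →ₐ[ℂ] B) (q : MvPolynomial σ A) :
    map (φ : A →+* B) q = coeffwise φ.toLinearMap q := by
  ext d
  simp [coeff_map]

theorem map_eval_eq_coeffwise (x : ℂ) (q : MvPolynomial σ (Polynomial ℂ)) :
    MvPolynomial.map (Polynomial.evalRingHom x) q =
      coeffwise (Polynomial.aeval x).toLinearMap q := by
  rw [← map_eq_coeffwise]
  congr 1

theorem pderiv_coeffwise (ρ : A →ₗ[ℂ] B) (q : MvPolynomial σ A) (v : σ) :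
    pderiv v (coeffwise ρ q) = coeffwise ρ (pderiv v q) := by
  ext d
  have h : ∀ (n : ℕ) (a : A), ρ (a * (n + 1)) = ρ a * (n + 1) := fun n a => by
    have := map_nsmul ρ (n + 1) a
    simpa [nsmul_eq_mul, mul_comm] using this
  simp [coeff_pderiv, h]

/-- Evaluating at a complex point commutes with a coefficientwise linear functional. -/
theorem eval_coeffwise (ρ : A →ₗ[ℂ] ℂ) (q : MvPolynomial σ A) (a : σ → ℂ) :
    eval a (coeffwise ρ q) = ρ (eval (fun v => algebraMap ℂ A (a v)) q) := by
  rw [coeffwise, map_sum, eval_eq, map_sum]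
  refine Finset.sum_congr rfl fun d _ => ?_
  have h : ∏ i ∈ d.support, algebraMap ℂ A (a i) ^ d i
      = algebraMap ℂ A (∏ i ∈ d.support, a i ^ d i) := by simp
  rw [h, mul_comm, ← Algebra.smul_def, map_smul, eval_monomial, smul_eq_mul, mul_comm, Finsupp.prod]

/-- Duality principle: if the functionals in `R` determine the functional `ρ` on a space `V` that
contains every coefficient of `q`, then a subspace that contains `coeffwise τ q` for each `τ ∈ R`
also contains `coeffwise ρ q`. -/
theorem coeffwise_mem (V : Submodule ℂ A) {q : MvPolynomial σ A} (hq : ∀ d, q.coeff d ∈ V)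
    (W : Submodule ℂ (MvPolynomial σ ℂ)) (R : Set (A →ₗ[ℂ] ℂ)) (ρ : A →ₗ[ℂ] ℂ)
    (hρ : ∀ n ∈ V, (∀ τ ∈ R, τ n = 0) → ρ n = 0) (hW : ∀ τ ∈ R, coeffwise τ q ∈ W) :
    coeffwise ρ q ∈ W := by
  by_contra hmem
  obtain ⟨f, hf, hWf⟩ := Submodule.exists_le_ker_of_notMem hmem
  have key : ∀ τ : A →ₗ[ℂ] ℂ, f (coeffwise τ q) =
      τ (∑ d ∈ q.support, f (monomial d 1) • q.coeff d) := fun τ => by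
    rw [coeffwise, map_sum, map_sum]
    refine Finset.sum_congr rfl fun d _ => ?_
    rw [map_smul, smul_eq_mul, mul_comm, ← smul_eq_mul, ← map_smul, smul_monomial, smul_eq_mul,
      mul_one]
  refine hf ?_
  rw [key]
  refine hρ _ (V.sum_mem fun d _ => V.smul_mem _ (hq d)) fun τ hτ => ?_
  rw [← key]
  exact hWf (hW τ hτ)

/-- Values at infinitely many points determine every linear functional on `ℂ[z]`. -/
theorem coeffwise_mem_of_infinite {q : MvPolynomial σ (Polynomial ℂ)}
    (W : Submodule ℂ (MvPolynomial σ ℂ)) {U : Set ℂ} (hU : U.Infinite)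
    (hW : ∀ x ∈ U, map (Polynomial.evalRingHom x) q ∈ W) (ρ : Polynomial ℂ →ₗ[ℂ] ℂ) :
    coeffwise ρ q ∈ W := by
  refine coeffwise_mem ⊤ (fun _ => Submodule.mem_top) W
    ((fun x => (Polynomial.aeval x).toLinearMap) '' U) ρ (fun n _ hn => ?_) ?_
  · have : n = 0 := Polynomial.eq_zero_of_infinite_isRoot n (hU.mono fun x hx => by
      have := hn _ ⟨x, hx, rfl⟩
      simpa [Polynomial.aeval_def, Polynomial.eval₂_eq_eval_map] using this)
    rw [this, map_zero]
  · rintro _ ⟨x, hx, rfl⟩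
    rw [← map_eval_eq_coeffwise]
    exact hW x hx

end Coeffwise

/-! ### The Jacobian criterion -/

section Jacobian

open MvPolynomial

variable {ι σ : Type*}

theorem _root_.MvPolynomial.eq_C_of_pderiv_eq_zero {P : MvPolynomial ι ℂ}
    (h : ∀ i, pderiv i P = 0) : P = C (P.coeff 0) := by
  classical
  ext d
  rw [coeff_C]
  split_ifs with hd
  · rw [hd]
  · obtain ⟨i, hi⟩ : ∃ i, d i ≠ 0 := by
      by_contra! hc
      exact hd (Finsupp.ext fun i => (hc i).symm)
    have h1 := congrArg (coeff (d - Finsupp.single i 1)) (h i)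
    have h2 : d - Finsupp.single i 1 + Finsupp.single i 1 = d := by
      ext j
      by_cases hj : i = j
      · subst hj
        simp
        omega
      · simp [hj]
    rw [coeff_pderiv, h2, coeff_zero] at h1
    exact (mul_eq_zero.1 h1).resolve_right (Nat.cast_add_one_ne_zero _)

theorem _root_.MvPolynomial.totalDegree_pderiv_lt {P : MvPolynomial ι ℂ} {i : ι}
    (h : pderiv i P ≠ 0) : (pderiv i P).totalDegree < P.totalDegree := by
  obtain ⟨d, hd, hdeg⟩ := Finset.exists_mem_eq_sup _ (support_nonempty.2 h)
    (fun s : ι →₀ ℕ => s.sum fun _ e => e)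
  have h1 : d + Finsupp.single i 1 ∈ P.support := by
    rw [mem_support_iff] at hd ⊢
    rw [coeff_pderiv] at hd
    exact left_ne_zero_of_mul hd
  have h2 := le_totalDegree h1
  rw [totalDegree, hdeg]
  rw [Finsupp.sum_add_index' (fun _ => rfl) (fun _ _ _ => rfl), Finsupp.sum_single_index rfl] at h2
  omega

theorem pderiv_aeval [Fintype ι] (x : ι → MvPolynomial σ ℂ) (P : MvPolynomial ι ℂ) (v : σ) :
    pderiv v (aeval x P) = ∑ i, aeval x (pderiv i P) * pderiv v (x i) := by
  classical
  induction P using MvPolynomial.induction_on with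
  | C a => simp [algebraMap_eq]
  | add p q hp hq => simp only [map_add, hp, hq, add_mul, Finset.sum_add_distrib]
  | mul_X p i hp =>
    simp only [map_mul, aeval_X, Derivation.leibniz, hp, pderiv_X, smul_eq_mul, map_add, add_mul,
      Finset.sum_add_distrib, Finset.mul_sum]
    congr 1
    · rw [Finset.sum_eq_single i]
      · simp
      · intro j _ hj
        simp [hj.symm]
      · simp
    · refine Finset.sum_congr rfl fun j _ => by ring

/-- Jacobian criterion: polynomials whose differentials are linearly independent at one point are
algebraically independent. -/
theorem algebraicIndependent_of_jacobian [Fintype ι] [Fintype σ] (x : ι → MvPolynomial σ ℂ)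
    (a : σ → ℂ) (h : LinearIndependent ℂ fun i => fun v => eval a (pderiv v (x i))) :
    AlgebraicIndependent ℂ x := by
  classical
  -- a right inverse of the Jacobian at `a` makes one minor of the Jacobian a nonzero polynomial
  obtain ⟨R, hR⟩ : ∃ R : Matrix σ ι ℂ, (Matrix.of fun i v => eval a (pderiv v (x i))) * R = 1 := by
    refine Matrix.mulVec_surjective_iff_exists_right_inverse.1 ?_
    rw [← Matrix.coe_mulVecLin, ← LinearMap.range_eq_top]
    refine Submodule.eq_top_of_finrank_eq ?_
    rw [Module.finrank_fintype_fun_eq_card]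
    exact LinearIndependent.rank_matrix h
  let J : Matrix ι σ (MvPolynomial σ ℂ) := Matrix.of fun i v => pderiv v (x i)
  let R' : Matrix σ ι (MvPolynomial σ ℂ) := R.map C
  have hdet : (J * R').det ≠ 0 := fun h0 => by
    have h1 := congrArg (eval a) h0
    rw [RingHom.map_det, map_zero] at h1
    have h2 : (eval a).mapMatrix (J * R') = 1 := by
      rw [← hR, RingHom.mapMatrix_apply, Matrix.map_mul]
      congr 1
      ext i j
      simp [R']
    simp [h2] at h1
  have hker : ∀ g : ι → MvPolynomial σ ℂ, (∀ v, ∑ i, g i * pderiv v (x i) = 0) → g = 0 := by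
    intro g hg
    refine Matrix.eq_zero_of_vecMul_eq_zero hdet ?_
    have : Matrix.vecMul g J = 0 := funext hg
    rw [← Matrix.vecMul_vecMul, this, Matrix.zero_vecMul]
  rw [algebraicIndependent_iff]
  intro P
  induction hn : P.totalDegree using Nat.strong_induction_on generalizing P with
  | _ n ih =>
    intro hP
    have h0 : ∀ i, pderiv i P = 0 := by
      have h1 := hker (fun i => aeval x (pderiv i P)) fun v => by
        rw [← pderiv_aeval, hP, map_zero]
      intro i
      by_contra hi
      exact hi (ih _ (hn ▸ totalDegree_pderiv_lt hi) _ rfl (congrFun h1 i))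
    rw [eq_C_of_pderiv_eq_zero h0] at hP ⊢
    rw [aeval_C, algebraMap_eq, C_eq_zero] at hP
    rw [hP, C_0]

end Jacobian

/-! ### Laurent expansions and residues -/

section Residue

open Polynomial

variable {F : Type*} [Field F]

open scoped RatFunc in
/-- The Laurent expansion of a rational function at `p`, as a ring homomorphism. -/
noncomputable def expandAt (p : F) : RatFunc F →+* LaurentSeries F :=
  (algebraMap (RatFunc F) (LaurentSeries F)).comp (RatFunc.laurent p : RatFunc F →+* RatFunc F)

open scoped RatFunc in
theorem expandAt_algebraMap (p : F) (n : F[X]) :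
    expandAt p (algebraMap F[X] (RatFunc F) n) =
      HahnSeries.ofPowerSeries ℤ F ((taylor p n : F[X]) : PowerSeries F) := by
  rw [expandAt, RingHom.comp_apply, RingHom.coe_coe, RatFunc.laurent_algebraMap, RatFunc.coe_coe]
  rfl

theorem expandAt_C (p c : F) : expandAt p (RatFunc.C c) = HahnSeries.C c := by
  rw [← RatFunc.algebraMap_C, expandAt_algebraMap, taylor_C, Polynomial.coe_C, PowerSeries.coe_C]

theorem expandAt_X_sub_C (p : F) :
    expandAt p (RatFunc.X - RatFunc.C p) = HahnSeries.single 1 1 := by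
  rw [← RatFunc.algebraMap_C, ← RatFunc.algebraMap_X, ← map_sub, expandAt_algebraMap]
  simp

/-- A numerator is divisible by `(z - p) ^ a` as soon as the `a` Laurent coefficients in the
singular part at `p` vanish. -/
theorem X_sub_C_pow_dvd_of_coeff_expandAt (p : F) (n Q : F[X]) (hQ : Q.eval p ≠ 0) (a : ℕ)
    (h : ∀ l < a, (expandAt p ((RatFunc.X - RatFunc.C p) ^ l * (algebraMap F[X] (RatFunc F) n /
      algebraMap F[X] (RatFunc F) ((X - C p) ^ a * Q)))).coeff (-1) = 0) :
    (X - C p) ^ a ∣ n := by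
  set q : PowerSeries F := ((taylor p Q : F[X]) : PowerSeries F) with hq
  have hq0 : PowerSeries.constantCoeff q ≠ 0 := by
    rw [← PowerSeries.coeff_zero_eq_constantCoeff_apply, hq, Polynomial.coeff_coe,
      taylor_coeff_zero]
    exact hQ
  set H : PowerSeries F := ((taylor p n : F[X]) : PowerSeries F) * q⁻¹ with hH
  have hHq : ((taylor p n : F[X]) : PowerSeries F) = H * q := by
    rw [hH, mul_assoc, PowerSeries.inv_mul_cancel _ hq0, mul_one]
  have hq1 : HahnSeries.ofPowerSeries ℤ F q ≠ 0 := by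
    rw [Ne, map_eq_zero_iff _ HahnSeries.ofPowerSeries_injective]
    rintro h0
    simp [h0] at hq0
  have hT : (HahnSeries.single 1 1 : LaurentSeries F) ≠ 0 := HahnSeries.single_ne_zero one_ne_zero
  have hcoeff : ∀ j < a, PowerSeries.coeff j H = 0 := by
    intro j hj
    have h1 := h (a - 1 - j) (by omega)
    have h2 : algebraMap F[X] (RatFunc F) ((X - C p) ^ a * Q) =
        (RatFunc.X - RatFunc.C p) ^ a * algebraMap F[X] (RatFunc F) Q := by simp
    have h3 : (HahnSeries.single 1 1 : LaurentSeries F) ^ (a - 1 - j) *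
        (HahnSeries.ofPowerSeries ℤ F H * HahnSeries.ofPowerSeries ℤ F q /
          ((HahnSeries.single 1 1) ^ a * HahnSeries.ofPowerSeries ℤ F q)) =
        HahnSeries.single (-1 - (j : ℤ)) 1 * HahnSeries.ofPowerSeries ℤ F H := by
      have h5 : (HahnSeries.single (-1 - (j : ℤ)) 1 : LaurentSeries F) =
          HahnSeries.single 1 1 ^ (a - 1 - j) / HahnSeries.single 1 1 ^ a := by
        rw [RatFunc.single_zpow, ← zpow_natCast, ← zpow_natCast, ← zpow_sub₀ hT]
        congr 1
        omega
      rw [h5, mul_div_mul_right _ _ hq1, mul_div_assoc', div_mul_eq_mul_div]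
    rw [h2, map_mul, map_pow, map_div₀, map_mul, map_pow, expandAt_X_sub_C, expandAt_algebraMap,
      expandAt_algebraMap, hHq, map_mul, h3] at h1
    have h4 := HahnSeries.coeff_single_mul_add (r := (1 : F))
      (x := HahnSeries.ofPowerSeries ℤ F H) (a := (j : ℤ)) (b := -1 - (j : ℤ))
    rw [add_sub_cancel, h1, one_mul, LaurentSeries.coeff_coe_powerSeries] at h4
    exact h4.symm
  have hdvd : (X : F[X]) ^ a ∣ taylor p n := by
    rw [X_pow_dvd_iff]
    intro d hd
    rw [← Polynomial.coeff_coe, hHq, PowerSeries.coeff_mul]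
    refine Finset.sum_eq_zero fun x hx => ?_
    rw [hcoeff x.1 (by have := Finset.HasAntidiagonal.mem_antidiagonal.1 hx; omega), zero_mul]
  obtain ⟨g, hg⟩ := hdvd
  refine ⟨taylor (-p) g, taylor_injective p ?_⟩
  rw [hg, taylor_mul, taylor_pow, taylor_taylor]
  simp

end Residue

/-- The residue at `p`, as a linear functional on `ℂ(z)`. -/
noncomputable def residueₗ (p : ℂ) : RatFunc ℂ →ₗ[ℂ] ℂ where
  toFun := residue p
  map_add' f g := by
    change (expandAt p (f + g)).coeff (-1) = (expandAt p f).coeff (-1) + (expandAt p g).coeff (-1)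
    rw [map_add, HahnSeries.coeff_add]
  map_smul' c f := by
    change (expandAt p (c • f)).coeff (-1) = c * (expandAt p f).coeff (-1)
    rw [RatFunc.smul_eq_C_mul]
    erw [map_mul, expandAt_C]
    rw [HahnSeries.C_mul_eq_smul, HahnSeries.coeff_smul, smul_eq_mul]

theorem residueFun_eq_coeffwise {N r : ℕ} (p : ℂ) (f : Fun (RatFunc ℂ) N r) :
    residueFun p f = coeffwise (residueₗ p) f := rfl

/-- The functional `n ↦ Res_{z = p} (g n)` on polynomials `n`, for a fixed rational function `g`. -/
noncomputable def residueMul (p : ℂ) (g : RatFunc ℂ) : Polynomial ℂ →ₗ[ℂ] ℂ :=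
  residueₗ p ∘ₗ LinearMap.mulLeft ℂ g ∘ₗ
    (Algebra.linearMap (Polynomial ℂ) (RatFunc ℂ)).restrictScalars ℂ

theorem residueMul_apply (p : ℂ) (g : RatFunc ℂ) (n : Polynomial ℂ) :
    residueMul p g n = (expandAt p (g * algebraMap _ _ n)).coeff (-1) := rfl

theorem residueFun_C_mul_map {N r : ℕ} (p : ℂ) (g : RatFunc ℂ)
    (q : MvPolynomial (Fin N × Fin r × Fin r) (Polynomial ℂ)) :
    residueFun p (MvPolynomial.C g * MvPolynomial.map (algebraMap (Polynomial ℂ) (RatFunc ℂ)) q) =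
      coeffwise (residueMul p g) q := by
  rw [residueFun_eq_coeffwise]
  ext d
  rw [coeff_coeffwise, coeff_coeffwise, MvPolynomial.coeff_C_mul, MvPolynomial.coeff_map]
  rfl

open Polynomial in
/-- A proper fraction whose denominator is a power of a product of distinct linear factors is
determined by its principal parts. -/
theorem eq_zero_of_residueMul_eq_zero {ι : Type*} [Fintype ι] {ν : ι → ℂ}
    (hν : Function.Injective ν) (a : ℕ) (n : ℂ[X])
    (hn : n.degree < ((a * Fintype.card ι : ℕ) : WithBot ℕ))
    (h : ∀ i, ∀ l < a, residueMul (ν i) ((RatFunc.X - RatFunc.C (ν i)) ^ l /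
      algebraMap ℂ[X] (RatFunc ℂ) ((∏ j, (X - C (ν j))) ^ a)) n = 0) : n = 0 := by
  classical
  have hdvd : ∏ j, (X - C (ν j)) ^ a ∣ n := by
    refine Finset.prod_dvd_of_coprime (fun i _ j _ hij =>
      (pairwise_coprime_X_sub_C hν hij).pow) fun i _ => ?_
    refine X_sub_C_pow_dvd_of_coeff_expandAt (ν i) n
      ((∏ j ∈ Finset.univ.erase i, (X - C (ν j))) ^ a) ?_ a fun l hl => ?_
    · rw [eval_pow, eval_prod]
      refine pow_ne_zero _ (Finset.prod_ne_zero_iff.2 fun j hj => ?_)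
      simp only [eval_sub, eval_X, eval_C]
      exact sub_ne_zero.2 fun he => (Finset.ne_of_mem_erase hj) (hν he.symm)
    · rw [← h i l hl, residueMul_apply, ← mul_pow,
        Finset.mul_prod_erase _ (fun j => X - C (ν j)) (Finset.mem_univ i), mul_div_assoc',
        div_mul_eq_mul_div]
  by_contra h0
  have h1 := degree_le_of_dvd hdvd h0
  rw [Finset.prod_pow, degree_pow, degree_prod] at h1
  simp only [degree_X_sub_C, Finset.sum_const, Finset.card_univ] at h1
  refine absurd (lt_of_le_of_lt h1 hn) ?_
  simp

/-! ### Degrees in the spectral parameter -/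

section CoeffDegree

open Polynomial

variable {σ : Type*}

theorem natDegree_coeff_mul_le {p q : MvPolynomial σ ℂ[X]} {a b : ℕ}
    (hp : ∀ d, (p.coeff d).natDegree ≤ a) (hq : ∀ d, (q.coeff d).natDegree ≤ b) (d : σ →₀ ℕ) :
    ((p * q).coeff d).natDegree ≤ a + b := by
  classical
  rw [MvPolynomial.coeff_mul]
  exact natDegree_sum_le_of_forall_le _ _ fun x _ => natDegree_mul_le_of_le (hp _) (hq _)

theorem natDegree_coeff_sum_le {ι : Type*} (s : Finset ι) {p : ι → MvPolynomial σ ℂ[X]} {a : ℕ}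
    (hp : ∀ i ∈ s, ∀ d, ((p i).coeff d).natDegree ≤ a) (d : σ →₀ ℕ) :
    ((∑ i ∈ s, p i).coeff d).natDegree ≤ a := by
  rw [MvPolynomial.coeff_sum]
  exact natDegree_sum_le_of_forall_le _ _ fun i hi => hp i hi d

theorem natDegree_coeff_matrix_pow_le {n : Type*} [Fintype n] [DecidableEq n]
    {M : Matrix n n (MvPolynomial σ ℂ[X])} {a : ℕ}
    (hM : ∀ i j d, ((M i j).coeff d).natDegree ≤ a) (s : ℕ) (i j : n) (d : σ →₀ ℕ) :
    (((M ^ s) i j).coeff d).natDegree ≤ s * a := by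
  classical
  induction s generalizing i j d with
  | zero =>
    rw [pow_zero, Matrix.one_apply]
    split_ifs
    · rw [MvPolynomial.coeff_one]
      split_ifs <;> simp
    · simp
  | succ s ih =>
    rw [pow_succ, Matrix.mul_apply, Nat.succ_mul]
    exact natDegree_coeff_sum_le _ (fun l _ => natDegree_coeff_mul_le (ih i l) (hM l j)) d

theorem natDegree_coeff_trace_pow_le {n : Type*} [Fintype n] [DecidableEq n]
    {M : Matrix n n (MvPolynomial σ ℂ[X])} {a : ℕ}
    (hM : ∀ i j d, ((M i j).coeff d).natDegree ≤ a) (s : ℕ) (d : σ →₀ ℕ) :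
    ((M ^ s).trace.coeff d).natDegree ≤ s * a :=
  natDegree_coeff_sum_le _ (fun i _ => natDegree_coeff_matrix_pow_le hM s i i) d

end CoeffDegree

/-! ### Lax matrices and their values -/

section Lax

variable {N r : ℕ} {ι : Type*} [Fintype ι]

/-- The Lax matrix `∑ i, Y_i / (z - ν_i)` with arbitrary matrix coefficients `Y_i` over the phase
space. The nodes `ν_i` need not be distinct. -/
noncomputable def ratLax (ν : ι → ℂ) (Y : ι → Matrix (Fin r) (Fin r) (Fun ℂ N r)) :
    Matrix (Fin r) (Fin r) (Fun (RatFunc ℂ) N r) :=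
  ∑ i, invSub (ν i) • (Y i).map (MvPolynomial.map (algebraMap ℂ (RatFunc ℂ)))

/-- The value at the spectral parameter `x` of the Lax matrix `∑ i, Y_i / (z - ν_i)`. It is
meaningful for `x` different from all nodes `ν_i`. -/
noncomputable def evalLax (ν : ι → ℂ) (Y : ι → Matrix (Fin r) (Fin r) (Fun ℂ N r)) (x : ℂ) :
    Matrix (Fin r) (Fin r) (Fun ℂ N r) :=
  ∑ i, (x - ν i)⁻¹ • Y i

/-- The Lax matrix multiplied by the denominator `∏ i, (z - ν_i)`; its coefficients are
polynomials in `z`. -/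
noncomputable def clearedLax [DecidableEq ι] (ν : ι → ℂ)
    (Y : ι → Matrix (Fin r) (Fin r) (Fun ℂ N r)) :
    Matrix (Fin r) (Fin r) (MvPolynomial (Fin N × Fin r × Fin r) (Polynomial ℂ)) :=
  ∑ i, (∏ j ∈ Finset.univ.erase i, (Polynomial.X - Polynomial.C (ν j))) •
    (Y i).map (MvPolynomial.map Polynomial.C)

theorem map_matrix_smul {A B : Type*} [CommRing A] [CommRing B] {σ : Type*} {n : Type*}
    (φ : A →+* B) (a : A) (M : Matrix n n (MvPolynomial σ A)) :
    (a • M).map (MvPolynomial.map φ) = φ a • M.map (MvPolynomial.map φ) := by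
  ext i j : 2
  simp [MvPolynomial.smul_eq_C_mul]

theorem map_matrix_sum {R S : Type*} [CommRing R] [CommRing S] {n κ : Type*} (s : Finset κ)
    (φ : R →+* S) (M : κ → Matrix n n R) : (∑ i ∈ s, M i).map φ = ∑ i ∈ s, (M i).map φ := by
  ext i j
  simp [Matrix.sum_apply]

theorem map_trace_pow {R S : Type*} [CommRing R] [CommRing S] {n : Type*} [Fintype n]
    [DecidableEq n] (φ : R →+* S) (M : Matrix n n R) (a : ℕ) :
    φ (M ^ a).trace = ((M.map φ) ^ a).trace := by
  rw [← RingHom.mapMatrix_apply, ← map_pow, RingHom.mapMatrix_apply]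
  simp [Matrix.trace]

theorem map_map_eval_C {σ n : Type*} (x : ℂ) (M : Matrix n n (MvPolynomial σ ℂ)) :
    (M.map (MvPolynomial.map Polynomial.C)).map
      (MvPolynomial.map (Polynomial.evalRingHom x)) = M := by
  have h : (Polynomial.evalRingHom x).comp Polynomial.C = RingHom.id ℂ := by ext; simp
  ext a b : 2
  rw [Matrix.map_apply, Matrix.map_apply, MvPolynomial.map_map, h, MvPolynomial.map_id]

theorem trace_smul_pow {R S : Type*} [CommRing R] [CommRing S] [Algebra R S] {n : Type*}
    [Fintype n] [DecidableEq n] (c : R) (M : Matrix n n S) (a : ℕ) :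
    ((c • M) ^ a).trace = c ^ a • (M ^ a).trace := by
  rw [smul_pow, Matrix.trace_smul]

variable [DecidableEq ι] (ν : ι → ℂ) (Y : ι → Matrix (Fin r) (Fin r) (Fun ℂ N r))

theorem clearedLax_map_algebraMap :
    (clearedLax ν Y).map (MvPolynomial.map (algebraMap (Polynomial ℂ) (RatFunc ℂ))) =
      algebraMap (Polynomial ℂ) (RatFunc ℂ) (∏ i, (Polynomial.X - Polynomial.C (ν i))) •
        ratLax ν Y := by
  rw [clearedLax, ratLax, map_matrix_sum, Finset.smul_sum]
  refine Finset.sum_congr rfl fun i _ => ?_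
  rw [map_matrix_smul, Matrix.map_map, smul_smul]
  congr 1
  · rw [← Finset.mul_prod_erase _ _ (Finset.mem_univ i), map_mul, invSub, mul_right_comm, map_sub,
      RatFunc.algebraMap_X, RatFunc.algebraMap_C, mul_one_div_cancel, one_mul]
    rw [← RatFunc.algebraMap_C, ← RatFunc.algebraMap_X, ← map_sub]
    exact RatFunc.algebraMap_ne_zero (Polynomial.X_sub_C_ne_zero _)
  · congr 1
    funext f
    rw [Function.comp_apply, MvPolynomial.map_map]
    rfl

theorem clearedLax_map_eval {x : ℂ} (hx : ∀ i, x ≠ ν i) :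
    (clearedLax ν Y).map (MvPolynomial.map (Polynomial.evalRingHom x)) =
      (∏ i, (x - ν i)) • evalLax ν Y x := by
  rw [clearedLax, evalLax, map_matrix_sum, Finset.smul_sum]
  refine Finset.sum_congr rfl fun i _ => ?_
  rw [map_matrix_smul, map_map_eval_C, smul_smul]
  congr 1
  · rw [← Finset.mul_prod_erase _ _ (Finset.mem_univ i), mul_right_comm,
      mul_inv_cancel₀ (sub_ne_zero.2 (hx i)), one_mul]
    simp

theorem trace_ratLax_pow (a : ℕ) :
    (ratLax ν Y ^ a).trace =
      MvPolynomial.C (1 / algebraMap (Polynomial ℂ) (RatFunc ℂ)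
        ((∏ i, (Polynomial.X - Polynomial.C (ν i))) ^ a)) *
      MvPolynomial.map (algebraMap (Polynomial ℂ) (RatFunc ℂ)) (clearedLax ν Y ^ a).trace := by
  have h0 : algebraMap (Polynomial ℂ) (RatFunc ℂ)
      ((∏ i, (Polynomial.X - Polynomial.C (ν i))) ^ a) ≠ 0 :=
    RatFunc.algebraMap_ne_zero (pow_ne_zero _ (Finset.prod_ne_zero_iff.2 fun i _ =>
      Polynomial.X_sub_C_ne_zero _))
  rw [map_trace_pow, clearedLax_map_algebraMap, trace_smul_pow, ← map_pow,
    MvPolynomial.smul_eq_C_mul, ← mul_assoc, ← map_mul, one_div_mul_cancel h0, map_one, one_mul]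

theorem map_eval_trace_clearedLax_pow (a : ℕ) {x : ℂ} (hx : ∀ i, x ≠ ν i) :
    MvPolynomial.map (Polynomial.evalRingHom x) (clearedLax ν Y ^ a).trace =
      (∏ i, (x - ν i)) ^ a • (evalLax ν Y x ^ a).trace := by
  rw [map_trace_pow, clearedLax_map_eval ν Y hx, trace_smul_pow]

/-- A linear space that contains `Tr (L(x) ^ a)` for infinitely many `x` contains everything that
depends linearly on the numerator of `Tr (L(z) ^ a)`. -/
theorem coeffwise_trace_clearedLax_mem (W : Submodule ℂ (Fun ℂ N r)) {U : Set ℂ}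
    (hU : U.Infinite) (hUν : ∀ x ∈ U, ∀ i, x ≠ ν i) (a : ℕ)
    (hW : ∀ x ∈ U, (evalLax ν Y x ^ a).trace ∈ W) (ρ : Polynomial ℂ →ₗ[ℂ] ℂ) :
    coeffwise ρ (clearedLax ν Y ^ a).trace ∈ W := by
  refine coeffwise_mem_of_infinite W hU (fun x hx => ?_) ρ
  rw [map_eval_trace_clearedLax_pow ν Y a (hUν x hx)]
  exact W.smul_mem _ (hW x hx)

theorem residueFun_trace_mem (W : Submodule ℂ (Fun ℂ N r)) {U : Set ℂ}
    (hU : U.Infinite) (hUν : ∀ x ∈ U, ∀ i, x ≠ ν i) (a : ℕ)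
    (hW : ∀ x ∈ U, (evalLax ν Y x ^ a).trace ∈ W) (p : ℂ) (g : RatFunc ℂ) :
    residueFun p (MvPolynomial.C g * (ratLax ν Y ^ a).trace) ∈ W := by
  rw [trace_ratLax_pow, ← mul_assoc, ← map_mul, residueFun_C_mul_map]
  exact coeffwise_trace_clearedLax_mem ν Y W hU hUν a hW _

theorem degree_coeff_trace_clearedLax_pow_lt {a : ℕ} (ha : 1 ≤ a)
    (d : (Fin N × Fin r × Fin r) →₀ ℕ) :
    ((clearedLax ν Y ^ a).trace.coeff d).degree < ((a * Fintype.card ι : ℕ) : WithBot ℕ) := by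
  rcases isEmpty_or_nonempty ι with h | h
  · simp [clearedLax, zero_pow (Nat.one_le_iff_ne_zero.1 ha)]
  · have hM : ∀ i j d, ((clearedLax ν Y i j).coeff d).natDegree ≤ Fintype.card ι - 1 := by
      intro i j d
      rw [clearedLax, Matrix.sum_apply]
      refine natDegree_coeff_sum_le _ (fun l _ d => ?_) d
      rw [Matrix.smul_apply, MvPolynomial.coeff_smul, smul_eq_mul, Matrix.map_apply,
        MvPolynomial.coeff_map]
      refine (Polynomial.natDegree_mul_C_le _ _).trans ?_
      rw [Polynomial.natDegree_prod_of_monic _ _ fun j _ => Polynomial.monic_X_sub_C _]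
      simp [Finset.card_erase_of_mem]
    refine lt_of_le_of_lt (Polynomial.degree_le_of_natDegree_le
      (natDegree_coeff_trace_pow_le hM a d)) ?_
    have : 0 < Fintype.card ι := Fintype.card_pos
    exact_mod_cast Nat.mul_lt_mul_of_pos_left (by omega) ha

/-- For distinct nodes, the values `Tr (L(x) ^ a)` are linear combinations of residues of
`(z - p) ^ l * Tr (L(z) ^ a)`: this is the partial fraction expansion. -/
theorem trace_evalLax_mem (hν : Function.Injective ν) (W : Submodule ℂ (Fun ℂ N r)) {a : ℕ}
    (ha : 1 ≤ a)
    (hW : ∀ i, ∀ l < a, residueFun (ν i) (MvPolynomial.C ((RatFunc.X - RatFunc.C (ν i)) ^ l) *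
      (ratLax ν Y ^ a).trace) ∈ W) {x : ℂ} (hx : ∀ i, x ≠ ν i) :
    (evalLax ν Y x ^ a).trace ∈ W := by
  have h0 : (∏ i, (x - ν i)) ^ a ≠ 0 :=
    pow_ne_zero _ (Finset.prod_ne_zero_iff.2 fun i _ => sub_ne_zero.2 (hx i))
  have h1 : (evalLax ν Y x ^ a).trace = ((∏ i, (x - ν i)) ^ a)⁻¹ •
      MvPolynomial.map (Polynomial.evalRingHom x) (clearedLax ν Y ^ a).trace := by
    rw [map_eval_trace_clearedLax_pow ν Y a hx, inv_smul_smul₀ h0]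
  rw [h1]
  refine W.smul_mem _ ?_
  rw [map_eval_eq_coeffwise]
  refine coeffwise_mem (Polynomial.degreeLT ℂ (a * Fintype.card ι)) (fun d =>
    Polynomial.mem_degreeLT.2 (degree_coeff_trace_clearedLax_pow_lt ν Y ha d)) W
    {τ | ∃ i, ∃ l < a, τ = residueMul (ν i) ((RatFunc.X - RatFunc.C (ν i)) ^ l /
      algebraMap (Polynomial ℂ) (RatFunc ℂ)
        ((∏ j, (Polynomial.X - Polynomial.C (ν j))) ^ a))} _ (fun n hn h => ?_) ?_
  · rw [eq_zero_of_residueMul_eq_zero hν a n (Polynomial.mem_degreeLT.1 hn) fun i l hl =>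
      h _ ⟨i, l, hl, rfl⟩, map_zero]
  · rintro _ ⟨i, l, hl, rfl⟩
    have := hW i l hl
    rwa [trace_ratLax_pow, ← mul_assoc, ← map_mul, residueFun_C_mul_map, mul_one_div] at this

end Lax

/-! ### Spectral invariants and values of traces -/

section Spectral

variable {N r : ℕ} {ι : Type*} [Fintype ι] (ν : ι → ℂ)
  (Y : ι → Matrix (Fin r) (Fin r) (Fun ℂ N r))

/-- The functions `Tr (L(x) ^ a)`, `1 ≤ a ≤ r`, for `x` in a set `U` of values of the spectral
parameter. -/
def traceValues (U : Set ℂ) : Set (Fun ℂ N r) :=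
  {h | ∃ x ∈ U, ∃ a ∈ Finset.Icc 1 r, h = (evalLax ν Y x ^ a).trace}

theorem spectralInvariants_subset_span {U : Set ℂ} (hU : U.Infinite)
    (hUν : ∀ x ∈ U, ∀ i, x ≠ ν i) (P : Set ℂ) :
    spectralInvariants (ratLax ν Y) P ⊆ Submodule.span ℂ (traceValues ν Y U) := by
  classical
  rintro _ ⟨p, -, a, ha, l, -, rfl⟩
  exact residueFun_trace_mem ν Y _ hU hUν a
    (fun x hx => Submodule.subset_span (show _ ∈ traceValues ν Y U from ⟨x, hx, a, ha, rfl⟩)) _ _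

theorem traceValues_subset_span (hν : Function.Injective ν) {U : Set ℂ}
    (hUν : ∀ x ∈ U, ∀ i, x ≠ ν i) :
    traceValues ν Y U ⊆
      Submodule.span ℂ (spectralInvariants (ratLax ν Y) (Set.range ν)) := by
  classical
  rintro _ ⟨x, hx, a, ha, rfl⟩
  exact trace_evalLax_mem ν Y hν _ (Finset.mem_Icc.1 ha).1 (fun i l hl =>
    Submodule.subset_span (show _ ∈ spectralInvariants (ratLax ν Y) (Set.range ν) from
      ⟨ν i, ⟨i, rfl⟩, a, ha, l, hl, rfl⟩)) (hUν x hx)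

/-- For distinct nodes, the spectral invariants and the values `Tr (L(x) ^ a)` at infinitely many
regular points `x` generate the same algebra. -/
theorem adjoin_spectralInvariants (hν : Function.Injective ν) {U : Set ℂ} (hU : U.Infinite)
    (hUν : ∀ x ∈ U, ∀ i, x ≠ ν i) :
    Algebra.adjoin ℂ (spectralInvariants (ratLax ν Y) (Set.range ν)) =
      Algebra.adjoin ℂ (traceValues ν Y U) := by
  refine le_antisymm ?_ ?_
  · rw [← Algebra.adjoin_span (R := ℂ) (s := traceValues ν Y U)]
    exact Algebra.adjoin_mono (spectralInvariants_subset_span ν Y hU hUν _)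
  · rw [← Algebra.adjoin_span (R := ℂ) (s := spectralInvariants (ratLax ν Y) (Set.range ν))]
    exact Algebra.adjoin_mono (traceValues_subset_span ν Y hν hUν)

end Spectral

/-! ### Derivatives of traces of powers -/

section Derivative

theorem trace_pow_mul_map_derivation {R A n : Type*} [CommRing R] [CommRing A] [Algebra R A]
    [Fintype n] [DecidableEq n] (D : Derivation R A A) (M : Matrix n n A) (a j : ℕ) :
    (M ^ j * (M ^ a).map D).trace = a * (M ^ (j + a - 1) * M.map D).trace := by
  have hmul : ∀ P Q : Matrix n n A, (P * Q).map D = P * Q.map D + P.map D * Q := fun P Q => by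
    ext p q
    simp only [Matrix.map_apply, Matrix.mul_apply, Matrix.add_apply, map_sum, Derivation.leibniz,
      Finset.sum_add_distrib, smul_eq_mul]
    congr 1
    exact Finset.sum_congr rfl fun l _ => mul_comm _ _
  induction a generalizing j with
  | zero =>
    have : (1 : Matrix n n A).map D = 0 := by
      ext p q
      rw [Matrix.map_apply, Matrix.one_apply]
      split_ifs <;> simp
    simp [this]
  | succ a ih =>
    rw [pow_succ, hmul, mul_add, Matrix.trace_add, ← mul_assoc, ← pow_add, ← mul_assoc,
      Matrix.trace_mul_comm _ M, ← mul_assoc, ← pow_succ', ih]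
    have h1 : j + 1 + a - 1 = j + a := by omega
    have h2 : j + (a + 1) - 1 = j + a := by omega
    rw [h1, h2]
    push_cast
    ring

theorem derivation_trace_pow {R A n : Type*} [CommRing R] [CommRing A] [Algebra R A]
    [Fintype n] [DecidableEq n] (D : Derivation R A A) (M : Matrix n n A) (a : ℕ) :
    D (M ^ a).trace = a * (M ^ (a - 1) * M.map D).trace := by
  have := trace_pow_mul_map_derivation D M a 0
  rw [pow_zero, one_mul, zero_add] at this
  rw [← this]
  simp [Matrix.trace]

/-- The partial derivatives of the trace of a power of a linear combination of the matrices
`X_i`. -/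
theorem pderiv_trace_pow {R : Type} [CommRing R] {N r : ℕ} (c : Fin N → R) (a : ℕ)
    (i : Fin N) (p q : Fin r) :
    MvPolynomial.pderiv (i, p, q) ((∑ j, c j • site R j) ^ a).trace =
      ((a : R) * c i) •
        ((∑ j, c j • site R j) ^ (a - 1) : Matrix (Fin r) (Fin r) (Fun R N r)) q p := by
  have h : (∑ j, c j • site R j : Matrix (Fin r) (Fin r) (Fun R N r)).map
      (MvPolynomial.pderiv (i, p, q)) = Matrix.single p q (MvPolynomial.C (c i)) := by
    ext s t : 2
    rw [Matrix.map_apply, Matrix.sum_apply, map_sum, Finset.sum_eq_single i]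
    · rw [Matrix.smul_apply, site, Matrix.of_apply, Derivation.map_smul, MvPolynomial.pderiv_X,
        Matrix.single_apply, MvPolynomial.smul_eq_C_mul]
      by_cases hst : p = s ∧ q = t
      · simp [hst.1, hst.2]
      · rw [if_neg hst, Pi.single_eq_of_ne, mul_zero]
        intro he
        simp only [Prod.mk.injEq, true_and] at he
        exact hst ⟨he.1.symm, he.2.symm⟩
    · intro j _ hj
      rw [Matrix.smul_apply, site, Matrix.of_apply, Derivation.map_smul, MvPolynomial.pderiv_X,
        Pi.single_eq_of_ne, smul_zero]
      intro he
      exact hj (congrArg Prod.fst he)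
    · simp
  rw [derivation_trace_pow, h, Matrix.trace_mul_single, MvPolynomial.smul_eq_C_mul, map_mul,
    map_natCast, mul_assoc, mul_comm (MvPolynomial.C (c i))]
  rfl

end Derivative

/-! ### The Poisson bracket -/

section Bracket

variable {N r : ℕ}

theorem grad_add (i : Fin N) (F G : Fun ℂ N r) : grad i (F + G) = grad i F + grad i G := by
  ext a b : 2
  simp [grad]

theorem grad_smul (i : Fin N) (c : ℂ) (F : Fun ℂ N r) : grad i (c • F) = c • grad i F := by
  ext a b : 2
  simp [grad]

theorem grad_mul (i : Fin N) (F G : Fun ℂ N r) :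
    grad i (F * G) = F • grad i G + G • grad i F := by
  ext a b : 2
  simp [grad]

/-- The Poisson bracket as a bilinear map. -/
noncomputable def bracketₗ : Fun ℂ N r →ₗ[ℂ] Fun ℂ N r →ₗ[ℂ] Fun ℂ N r :=
  LinearMap.mk₂ ℂ bracket
    (fun F F' G => by
      simp only [bracket, grad_add, add_mul, Matrix.trace_add, Finset.sum_add_distrib])
    (fun c F G => by
      simp only [bracket, grad_smul, smul_mul_assoc, Matrix.trace_smul, Finset.smul_sum])
    (fun F G G' => by
      simp only [bracket, grad_add, add_mul, mul_add, add_sub_add_comm, Matrix.trace_add,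
        Finset.sum_add_distrib])
    (fun c F G => by
      simp only [bracket, grad_smul, mul_smul_comm, smul_mul_assoc, ← smul_sub, Matrix.trace_smul,
        Finset.smul_sum])

theorem bracketₗ_apply (F G : Fun ℂ N r) : bracketₗ F G = bracket F G := rfl

theorem bracket_mul_right (F G H : Fun ℂ N r) :
    bracket F (G * H) = G * bracket F H + H * bracket F G := by
  simp only [bracket, Finset.mul_sum, ← Finset.sum_add_distrib]
  refine Finset.sum_congr rfl fun i _ => ?_
  have h : ∀ P Q : Matrix (Fin r) (Fin r) (Fun ℂ N r),
      G * P.trace + H * Q.trace = (G • P + H • Q).trace := fun P Q => by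
    rw [Matrix.trace_add, Matrix.trace_smul, Matrix.trace_smul, smul_eq_mul, smul_eq_mul]
  rw [grad_mul, h]
  congr 1
  simp only [mul_add, add_mul, mul_smul_comm, smul_mul_assoc, smul_sub, mul_sub]
  abel

theorem bracket_skew (F G : Fun ℂ N r) : bracket F G = -bracket G F := by
  simp only [bracket, ← Finset.sum_neg_distrib]
  refine Finset.sum_congr rfl fun i _ => ?_
  rw [mul_sub, mul_sub, Matrix.trace_sub, Matrix.trace_sub, neg_sub, ← mul_assoc, ← mul_assoc,
    ← mul_assoc, ← mul_assoc, Matrix.trace_mul_cycle (grad i F), Matrix.trace_mul_comm _ (grad i F),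
    ← mul_assoc, Matrix.trace_mul_cycle (grad i F) (grad i G), mul_assoc (site ℂ i),
    Matrix.trace_mul_comm (site ℂ i)]

theorem bracket_algebraMap_right (F : Fun ℂ N r) (c : ℂ) :
    bracket F (algebraMap ℂ _ c) = 0 := by
  have : ∀ i, grad i (algebraMap ℂ (Fun ℂ N r) c) = 0 := fun i => by
    ext a b : 2
    simp [grad]
  simp only [bracket, this, mul_zero, zero_mul, sub_zero, Matrix.trace_zero,
    Finset.sum_const_zero]

/-- Functions that commute on two sets commute on the linear spans. -/
theorem bracket_eq_zero_of_mem_span {s t : Set (Fun ℂ N r)}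
    (h : ∀ f ∈ s, ∀ g ∈ t, bracket f g = 0) {f g : Fun ℂ N r} (hf : f ∈ Submodule.span ℂ s)
    (hg : g ∈ Submodule.span ℂ t) : bracket f g = 0 := by
  have h1 : ∀ f' ∈ s, bracketₗ f' g = 0 := fun f' hf' =>
    LinearMap.mem_ker.1 (Submodule.span_le.2
      (fun g' hg' => LinearMap.mem_ker.2 (h f' hf' g' hg')) hg)
  have h2 : bracketₗ.flip g f = 0 := LinearMap.mem_ker.1 (Submodule.span_le.2
      (fun f' hf' => LinearMap.mem_ker.2 (h1 f' hf')) hf)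
  exact h2

theorem bracket_eq_zero_of_mem_adjoin_right {s : Set (Fun ℂ N r)} {f : Fun ℂ N r}
    (h : ∀ g ∈ s, bracket f g = 0) {g : Fun ℂ N r} (hg : g ∈ Algebra.adjoin ℂ s) :
    bracket f g = 0 := by
  induction hg using Algebra.adjoin_induction with
  | mem g hg => exact h g hg
  | algebraMap c => exact bracket_algebraMap_right f c
  | add g g' _ _ hg hg' =>
    rw [← bracketₗ_apply, map_add, bracketₗ_apply, bracketₗ_apply, hg, hg', add_zero]
  | mul g g' _ _ hg hg' => rw [bracket_mul_right, hg, hg', mul_zero, mul_zero, add_zero]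

theorem bracket_eq_zero_of_mem_adjoin {s : Set (Fun ℂ N r)}
    (h : ∀ f ∈ s, ∀ g ∈ s, bracket f g = 0) {f g : Fun ℂ N r} (hf : f ∈ Algebra.adjoin ℂ s)
    (hg : g ∈ Algebra.adjoin ℂ s) : bracket f g = 0 := by
  refine bracket_eq_zero_of_mem_adjoin_right (fun g' hg' => ?_) hg
  rw [bracket_skew, neg_eq_zero]
  exact bracket_eq_zero_of_mem_adjoin_right (fun f' hf' => h g' hg' f' hf') hf

theorem grad_trace_pow (c : Fin N → ℂ) (a : ℕ) (i : Fin N) :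
    grad i ((∑ j, c j • site ℂ j : Matrix (Fin r) (Fin r) (Fun ℂ N r)) ^ a).trace =
      ((a : ℂ) * c i) • (∑ j, c j • site ℂ j) ^ (a - 1) := by
  ext p q : 2
  rw [grad, Matrix.of_apply, pderiv_trace_pow, Matrix.smul_apply]

/-- The traces of powers of `M = ∑ i, c_i X_i` and `M' = ∑ i, c'_i X_i` Poisson-commute as soon as
`∑ i, c_i c'_i X_i` is a linear combination of `M` and `M'`. -/
theorem bracket_trace_pow_eq_zero (c c' : Fin N → ℂ) (s t : ℂ)
    (h : ∀ i, c i * c' i = s * c i + t * c' i) (a b : ℕ) :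
    bracket ((∑ j, c j • site ℂ j : Matrix (Fin r) (Fin r) (Fun ℂ N r)) ^ a).trace
      ((∑ j, c' j • site ℂ j : Matrix (Fin r) (Fin r) (Fun ℂ N r)) ^ b).trace = 0 := by
  set M : Matrix (Fin r) (Fin r) (Fun ℂ N r) := ∑ j, c j • site ℂ j with hM
  set M' : Matrix (Fin r) (Fin r) (Fun ℂ N r) := ∑ j, c' j • site ℂ j with hM'
  let φ : Matrix (Fin r) (Fin r) (Fun ℂ N r) →ₗ[ℂ] Fun ℂ N r :=
    { toFun := fun Z => (M ^ (a - 1) * (Z * M' ^ (b - 1) - M' ^ (b - 1) * Z)).trace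
      map_add' := fun Z Z' => by
        rw [← Matrix.trace_add, ← mul_add]
        congr 2
        rw [add_mul, mul_add]
        abel
      map_smul' := fun e Z => by
        rw [smul_mul_assoc, mul_smul_comm, ← smul_sub, mul_smul_comm, Matrix.trace_smul]
        rfl }
  have h1 : φ M = 0 := by
    change (M ^ (a - 1) * (M * M' ^ (b - 1) - M' ^ (b - 1) * M)).trace = 0
    rw [mul_sub, Matrix.trace_sub, sub_eq_zero, ← mul_assoc, ← mul_assoc,
      Matrix.trace_mul_comm _ M, ← mul_assoc, ← pow_succ, ← pow_succ']
  have h2 : φ M' = 0 := by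
    change (M ^ (a - 1) * (M' * M' ^ (b - 1) - M' ^ (b - 1) * M')).trace = 0
    rw [← pow_succ, ← pow_succ', sub_self, mul_zero, Matrix.trace_zero]
  have h3 : ∀ i, (grad i (M ^ a).trace * (site ℂ i * grad i (M' ^ b).trace -
      grad i (M' ^ b).trace * site ℂ i)).trace = ((a : ℂ) * b * (c i * c' i)) • φ (site ℂ i) := by
    intro i
    rw [hM, hM', grad_trace_pow, grad_trace_pow, ← hM, ← hM']
    simp only [mul_smul_comm, smul_mul_assoc, ← smul_sub, Matrix.trace_smul, smul_smul]
    congr 1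
    ring
  have h4 : ∑ i, (c i * c' i) • site ℂ i = s • M + t • M' := by
    simp only [h, add_smul, mul_smul, Finset.sum_add_distrib, hM, hM', Finset.smul_sum]
  rw [bracket]
  simp only [h3, mul_smul ((a : ℂ) * b)]
  rw [← Finset.smul_sum]
  simp only [← map_smul, ← map_sum]
  rw [h4, map_smul, map_add, map_smul, map_smul, h1, h2, smul_zero, smul_zero, add_zero, smul_zero]

end Bracket

/-! ### Powers of the shift matrix plus a diagonal matrix -/

section BasePoint

variable {A : Type*} [CommRing A]

/-- The nilpotent matrix with ones on the first subdiagonal. -/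
def shiftMatrix (A : Type*) [CommRing A] (r : ℕ) : Matrix (Fin r) (Fin r) A :=
  Matrix.of fun i j => if i.val = j.val + 1 then 1 else 0

/-- The diagonal matrix with entries `1, 2, 4, 8, …`. -/
def dyadicMatrix (A : Type*) [CommRing A] (r : ℕ) : Matrix (Fin r) (Fin r) A :=
  Matrix.diagonal fun i => 2 ^ i.val

/-- The Gaussian binomial coefficient `[p + l choose p]` at `2`: the sum over all words in `p`
letters `shiftMatrix` and `l` letters `dyadicMatrix`, after moving the letters `dyadicMatrix` to
the right. -/
def gaussBinom : ℕ → ℕ → ℕ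
  | 0, _ => 1
  | _ + 1, 0 => 1
  | p + 1, l + 1 => 2 ^ (p + 1) * gaussBinom (p + 1) l + gaussBinom p (l + 1)

theorem gaussBinom_zero_right (p : ℕ) : gaussBinom p 0 = 1 := by
  cases p <;> simp [gaussBinom]

theorem gaussBinom_pos (p l : ℕ) : 0 < gaussBinom p l := by
  induction p generalizing l with
  | zero => simp [gaussBinom]
  | succ p ih =>
    cases l with
    | zero => simp [gaussBinom]
    | succ l =>
      rw [gaussBinom]
      exact Nat.add_pos_right _ (ih _)

theorem pencil_mul_apply {r : ℕ} (t : A) (M : Matrix (Fin r) (Fin r) A) (i q : Fin r) :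
    ((shiftMatrix A r + t • dyadicMatrix A r) * M) i q =
      t * 2 ^ i.val * M i q + ∑ j : Fin r, if i.val = j.val + 1 then M j q else 0 := by
  rw [add_mul, smul_mul_assoc, Matrix.add_apply, Matrix.smul_apply, dyadicMatrix,
    Matrix.diagonal_mul, Matrix.mul_apply, smul_eq_mul, mul_assoc, add_comm]
  simp [shiftMatrix]

/-- The entries of the powers of `shiftMatrix + t • dyadicMatrix`. -/
theorem pencil_pow_apply {r : ℕ} (t : A) (s : ℕ) (i q : Fin r) :
    ((i : ℕ) < q ∨ (q : ℕ) + s < i →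
      ((shiftMatrix A r + t • dyadicMatrix A r) ^ s) i q = 0) ∧
    (∀ p l, p + l = s → (i : ℕ) = q + p → ((shiftMatrix A r + t • dyadicMatrix A r) ^ s) i q =
      t ^ l * 2 ^ (q * l) * gaussBinom p l) := by
  induction s generalizing i with
  | zero =>
    refine ⟨fun h => ?_, fun p l hpl hi => ?_⟩
    · rw [pow_zero, Matrix.one_apply_ne]
      rintro rfl
      omega
    · obtain ⟨rfl, rfl⟩ : p = 0 ∧ l = 0 := by omega
      have : i = q := Fin.ext hi
      simp [this, gaussBinom]
  | succ s ih =>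
    rw [pow_succ', pencil_mul_apply]
    -- the sum picks the entry just above, if there is one
    have hsum : ∀ c : A, (∀ j : Fin r, (i : ℕ) = j + 1 →
        ((shiftMatrix A r + t • dyadicMatrix A r) ^ s) j q = c) → ((i : ℕ) = 0 → c = 0) →
        (∑ j : Fin r, if i.val = j.val + 1 then
          ((shiftMatrix A r + t • dyadicMatrix A r) ^ s) j q else 0) = c := by
      intro c hc h0
      rcases Nat.eq_zero_or_pos (i : ℕ) with hi | hi
      · rw [h0 hi]
        exact Finset.sum_eq_zero fun j _ => if_neg (by omega)
      · let j : Fin r := ⟨i - 1, by omega⟩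
        have hj : (i : ℕ) = j + 1 := by simp only [j]; omega
        rw [Finset.sum_eq_single j, if_pos hj, hc j hj]
        · intro j' _ hne
          exact if_neg fun h => hne (Fin.ext (by omega))
        · simp
    refine ⟨fun h => ?_, fun p l hpl hi => ?_⟩
    · rw [(ih i).1 (by omega), hsum 0 (fun j hj => (ih j).1 (by omega)) (fun _ => rfl)]
      simp
    · rcases p with _ | p
      · obtain ⟨l, rfl⟩ : ∃ l', l = l' + 1 := ⟨s, by omega⟩
        rw [(ih i).2 0 l (by omega) hi,
          hsum 0 (fun j hj => (ih j).1 (by omega)) (fun _ => rfl), hi]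
        simp only [gaussBinom]
        push_cast
        ring
      · rcases l with _ | l
        · rw [(ih i).1 (by omega),
            hsum _ (fun j hj => (ih j).2 p 0 (by omega) (by omega)) (fun h => by omega)]
          simp [gaussBinom_zero_right]
        · rw [(ih i).2 (p + 1) l (by omega) hi,
            hsum _ (fun j hj => (ih j).2 p (l + 1) (by omega) (by omega)) (fun h => by omega), hi]
          simp only [gaussBinom]
          push_cast
          ring

/-- For fixed `p`, the vectors `(2 ^ (q l) [p + l choose p])_q` with `l < n` are linearly
independent (Vandermonde). -/
theorem eq_zero_of_sum_gaussBinom (p n : ℕ) (g : Fin n → ℂ)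
    (h : ∀ q < n, ∑ l : Fin n, g l * (2 ^ (q * l.val) * gaussBinom p l) = 0) : g = 0 := by
  have hinj : Function.Injective fun l : Fin n => (2 : ℂ) ^ l.val := fun l l' hl =>
    Fin.ext (Nat.pow_right_injective le_rfl (by
      have h : (2 : ℂ) ^ l.val = 2 ^ l'.val := hl
      exact_mod_cast h))
  have h1 : (fun l => g l * (gaussBinom p l : ℂ)) = 0 := by
    refine Matrix.eq_zero_of_forall_index_sum_mul_pow_eq_zero hinj fun q => ?_
    rw [← h q q.2]
    refine Finset.sum_congr rfl fun l _ => ?_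
    ring
  funext l
  have h2 := congrFun h1 l
  exact (mul_eq_zero.1 h2).resolve_right (Nat.cast_ne_zero.2 (gaussBinom_pos p l).ne')

end BasePoint

/-! ### Differentials of traces at a base point -/

section Evaluation

variable {R : Type} [CommRing R] [Algebra ℂ R] {N r : ℕ} {τ : Type*} [Fintype τ]

/-- The point of the phase space where the matrix `X_i` is `∑ t, T i t • pt t`. -/
def basePoint (T : Matrix (Fin N) τ ℂ) (pt : τ → Matrix (Fin r) (Fin r) ℂ) :
    Fin N × Fin r × Fin r → ℂ :=
  fun v => ∑ t, T v.1 t * pt t v.2.1 v.2.2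

theorem map_eval_basePoint (T : Matrix (Fin N) τ ℂ) (pt : τ → Matrix (Fin r) (Fin r) ℂ)
    (c : Fin N → R) (m : τ → R) (hm : ∀ t, ∑ i, T i t • c i = m t) :
    (∑ i, c i • site R i : Matrix (Fin r) (Fin r) (Fun R N r)).map
      (MvPolynomial.eval fun v => algebraMap ℂ R (basePoint T pt v)) =
      ∑ t, m t • (pt t).map (algebraMap ℂ R) := by
  ext p q
  simp only [Matrix.map_apply, Matrix.sum_apply, Matrix.smul_apply, map_sum, site, Matrix.of_apply,
    MvPolynomial.smul_eval, MvPolynomial.eval_X, basePoint, map_mul, smul_eq_mul, Finset.mul_sum]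
  rw [Finset.sum_comm]
  refine Finset.sum_congr rfl fun t _ => ?_
  rw [← hm, Finset.sum_mul]
  refine Finset.sum_congr rfl fun i _ => ?_
  rw [Algebra.smul_def]
  ring

/-- The differential at `basePoint T pt` of the trace of a power of `∑ i, c_i X_i`, in the
directions given by the columns of `T`. -/
theorem sum_pderiv_trace_pow (T : Matrix (Fin N) τ ℂ) (pt : τ → Matrix (Fin r) (Fin r) ℂ)
    (c : Fin N → R) (m : τ → R) (hm : ∀ t, ∑ i, T i t • c i = m t) (s : ℕ) (t : τ)
    (p q : Fin r) :
    ∑ i, T i t • MvPolynomial.eval (fun v => algebraMap ℂ R (basePoint T pt v))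
      (MvPolynomial.pderiv (i, q, p)
        ((∑ j, c j • site R j : Matrix (Fin r) (Fin r) (Fun R N r)) ^ (s + 1)).trace) =
      ((s : R) + 1) * m t * ((∑ t, m t • (pt t).map (algebraMap ℂ R)) ^ s) p q := by
  have h : ∀ M : Matrix (Fin r) (Fin r) (Fun R N r),
      MvPolynomial.eval (fun v => algebraMap ℂ R (basePoint T pt v)) ((M ^ s) p q) =
      ((M.map (MvPolynomial.eval fun v => algebraMap ℂ R (basePoint T pt v))) ^ s) p q :=
    fun M => by
    rw [← RingHom.mapMatrix_apply, ← map_pow]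
    rfl
  simp only [pderiv_trace_pow, MvPolynomial.smul_eval, add_tsub_cancel_right, h,
    map_eval_basePoint T pt c m hm]
  rw [← hm t, Finset.mul_sum, Finset.sum_mul]
  refine Finset.sum_congr rfl fun i _ => ?_
  rw [Algebra.smul_def, Algebra.smul_def]
  push_cast
  ring

end Evaluation

/-! ### Algebraic independence of the coefficients of traces -/

section Independence

open Polynomial

variable {N r : ℕ} {κ : Type} [Fintype κ] (k : κ → ℕ)

/-- The index set of the algebraically independent generators: the traces `Tr Y ^ (α + 1)` of the
common constant term, and for each arm `c` the coefficients of `z ^ (1 + j + k_c l)` in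
`Tr (B_c(z) ^ (α + 1))`, where `j < k_c` and `l ≤ α`. -/
abbrev GenIndex (r : ℕ) (k : κ → ℕ) : Type :=
  Fin r ⊕ ((Σ c, Fin (k c)) × (Σ α : Fin r, Fin (α.val + 1)))

/-- The generators indexed by `GenIndex`, for arms `B_c(z) = ∑ i, b c i • X_i` with common
constant term `∑ i, y i • X_i`. -/
noncomputable def gen (b : κ → Fin N → ℂ[X]) (y : Fin N → ℂ) : GenIndex r k → Fun ℂ N r
  | Sum.inl α => ((∑ i, y i • site ℂ i : Matrix (Fin r) (Fin r) (Fun ℂ N r)) ^ (α.val + 1)).trace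
  | Sum.inr (⟨c, j⟩, ⟨α, l⟩) => coeffwise (lcoeff ℂ (1 + j + k c * l))
      ((∑ i, b c i • site ℂ[X] i : Matrix (Fin r) (Fin r) (Fun ℂ[X] N r)) ^ (α.val + 1)).trace

/-- The base point: the common constant term is the shift matrix, the top coefficient of each arm
is the dyadic diagonal matrix, and all other coefficients vanish. -/
def armPoint (r : ℕ) : Option (Σ c, Fin (k c)) → Matrix (Fin r) (Fin r) ℂ
  | none => shiftMatrix ℂ r
  | some ⟨c, j⟩ => if j.val + 1 = k c then dyadicMatrix ℂ r else 0

theorem shiftMatrix_map {R : Type*} [CommRing R] [Algebra ℂ R] (r : ℕ) :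
    (shiftMatrix ℂ r).map (algebraMap ℂ R) = shiftMatrix R r := by
  ext i j
  simp only [shiftMatrix, Matrix.map_apply, Matrix.of_apply]
  split_ifs <;> simp

theorem dyadicMatrix_map {R : Type*} [CommRing R] [Algebra ℂ R] (r : ℕ) :
    (dyadicMatrix ℂ r).map (algebraMap ℂ R) = dyadicMatrix R r := by
  ext i j
  simp only [dyadicMatrix, Matrix.map_apply, Matrix.diagonal_apply]
  split_ifs
  · rw [map_pow, map_ofNat]
  · simp

/-- At the base point the arm `c` is `shiftMatrix + t • dyadicMatrix`. -/
theorem sum_smul_armPoint {R : Type*} [CommRing R] [Algebra ℂ R]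
    (m : Option (Σ c, Fin (k c)) → R) (h0 : m none = 1) :
    ∑ t, m t • (armPoint k r t).map (algebraMap ℂ R) =
      shiftMatrix R r + (∑ t : Σ c, Fin (k c), if t.2.val + 1 = k t.1 then m (some t) else 0) •
        dyadicMatrix R r := by
  rw [Fintype.sum_option, h0, one_smul, armPoint, shiftMatrix_map, Finset.sum_smul]
  congr 1
  refine Finset.sum_congr rfl fun t _ => ?_
  rw [armPoint]
  split_ifs
  · rw [dyadicMatrix_map]
  · simp

variable [DecidableEq κ]

/-- The monomial of `B_c` that multiplies the matrix variable `t`. -/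
noncomputable def armMonomial (c : κ) : Option (Σ c, Fin (k c)) → ℂ[X]
  | none => 1
  | some ⟨c', j⟩ => if c' = c then X ^ (j.val + 1) else 0

theorem sum_armMonomial_top (c : κ) (hc : 0 < k c) :
    (∑ t : Σ c, Fin (k c), if t.2.val + 1 = k t.1 then armMonomial k c (some t) else 0) =
      X ^ k c := by
  rw [Finset.sum_eq_single ⟨c, ⟨k c - 1, by omega⟩⟩]
  · have : k c - 1 + 1 = k c := by omega
    simp [armMonomial, this]
  · rintro ⟨c', j⟩ _ hne
    split_ifs with hj
    · rw [armMonomial, if_neg]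
      rintro rfl
      refine hne ?_
      congr 1
      exact Fin.ext (by simp only at hj ⊢; omega)
    · rfl
  · simp

/-- The coefficients of the traces of powers of the arms are algebraically independent. -/
theorem algebraicIndependent_gen (b : κ → Fin N → ℂ[X]) (y : Fin N → ℂ)
    (T : Matrix (Fin N) (Option (Σ c, Fin (k c))) ℂ)
    (hy : ∀ t, ∑ i, T i t • y i = if t = none then 1 else 0)
    (hb : ∀ c t, ∑ i, T i t • b c i = armMonomial k c t) :
    AlgebraicIndependent ℂ (gen k b y : GenIndex r k → Fun ℂ N r) := by
  refine algebraicIndependent_of_jacobian _ (basePoint T (armPoint k r)) ?_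
  rw [Fintype.linearIndependent_iff]
  intro g hg
  -- a linear relation between the differentials, contracted with the columns of `T`
  have hdir : ∀ t p q, ∑ x, g x * ∑ i, T i t • MvPolynomial.eval (basePoint T (armPoint k r))
      (MvPolynomial.pderiv (i, q, p) (gen k b y x)) = 0 := by
    intro t p q
    have h1 : ∀ i, ∑ x, g x * MvPolynomial.eval (basePoint T (armPoint k r))
        (MvPolynomial.pderiv (i, q, p) (gen k b y x)) = 0 := fun i => by
      simpa using congrFun hg (i, q, p)
    simp only [Finset.mul_sum, smul_eq_mul]
    rw [Finset.sum_comm]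
    refine Finset.sum_eq_zero fun i _ => ?_
    rw [← mul_zero (T i t), ← h1 i, Finset.mul_sum]
    refine Finset.sum_congr rfl fun x _ => ?_
    ring
  have hinl : ∀ t p q (α : Fin r), ∑ i, T i t • MvPolynomial.eval (basePoint T (armPoint k r))
      (MvPolynomial.pderiv (i, q, p) (gen k b y (Sum.inl α))) =
      ((α : ℂ) + 1) * (if t = none then 1 else 0) * (shiftMatrix ℂ r ^ α.val) p q := by
    intro t p q α
    have h :=
      sum_pderiv_trace_pow T (armPoint k r) y (fun t => if t = none then 1 else 0) hy α t p q
    rw [sum_smul_armPoint k (fun t => if t = none then (1 : ℂ) else 0) (if_pos rfl)] at h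
    simpa [gen] using h
  have hinr : ∀ t p q (c : κ) (j : Fin (k c)) (α : Fin r) (l : Fin (α.val + 1)),
      ∑ i, T i t • MvPolynomial.eval (basePoint T (armPoint k r))
      (MvPolynomial.pderiv (i, q, p) (gen k b y (Sum.inr (⟨c, j⟩, ⟨α, l⟩)))) =
      (((α : ℂ[X]) + 1) * armMonomial k c t *
        ((shiftMatrix ℂ[X] r + (X : ℂ[X]) ^ k c • dyadicMatrix ℂ[X] r) ^ α.val) p q).coeff
          (1 + j + k c * l) := by
    intro t p q c j α l
    have h := sum_pderiv_trace_pow T (armPoint k r) (b c) (armMonomial k c) (hb c) α t p q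
    rw [sum_smul_armPoint k _ rfl, sum_armMonomial_top k c (by have := j.2; omega)] at h
    rw [← h, finsetSum_coeff]
    refine Finset.sum_congr rfl fun i _ => ?_
    rw [gen, pderiv_coeffwise, eval_coeffwise, lcoeff_apply, coeff_smul]
  have hcoeff : ∀ s j q l K G n : ℕ, (((s : ℂ[X]) + 1) * X ^ (j + 1) *
      (((X : ℂ[X]) ^ K) ^ l * 2 ^ (q * l) * (G : ℂ[X]))).coeff n =
      if n = j + 1 + K * l then ((s : ℂ) + 1) * (2 ^ (q * l) * G) else 0 := by
    intro s j q l K G n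
    rw [← coeff_C_mul_X_pow]
    congr 1
    simp only [map_mul, map_add, map_one, map_pow, map_natCast, map_ofNat]
    ring
  -- the coefficients of positive degree
  have hzero : ∀ x, g (Sum.inr x) = 0 := by
    rintro ⟨⟨c, j⟩, ⟨⟨α, hα⟩, ⟨l, hl⟩⟩⟩
    obtain ⟨p, rfl⟩ : ∃ p, α = p + l := ⟨α - l, by simp only at hl; omega⟩
    have hj := j.2
    -- the generators that contribute to the entries on the `p`-th subdiagonal
    let e : Fin (r - p) → (Σ c, Fin (k c)) × (Σ α : Fin r, Fin (α.val + 1)) := fun i =>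
      (⟨c, j⟩, ⟨⟨p + i, by omega⟩, ⟨i, by simp only; omega⟩⟩)
    have he : Function.Injective e := fun i i' hi => by
      simp only [e, Prod.mk.injEq, true_and, Sigma.mk.injEq, Fin.mk.injEq] at hi
      exact Fin.ext (by omega)
    have key := eq_zero_of_sum_gaussBinom p (r - p)
      (fun i => g (Sum.inr (e i)) * ((p + i.val : ℕ) + 1)) fun q hq => by
        have h := hdir (some ⟨c, j⟩) ⟨q + p, by omega⟩ ⟨q, by omega⟩
        rw [Fintype.sum_sum_type] at h
        simp only [hinl, reduceCtorEq, if_false, mul_zero, zero_mul, Finset.sum_const_zero,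
          zero_add] at h
        rw [← h]
        refine Fintype.sum_of_injective e he _ _ ?_ ?_
        · rintro ⟨⟨c', j'⟩, ⟨α', l'⟩⟩ hx
          rw [hinr]
          by_cases hc : c = c'
          · subst hc
            rw [armMonomial, if_pos rfl]
            by_cases hp : p ≤ (α' : ℕ)
            · rw [(pencil_pow_apply _ _ _ _).2 p (α' - p) (by omega) rfl, hcoeff, if_neg, mul_zero]
              intro hn
              -- comparing modulo `k c` forces the index to be in the range of `e`
              have hj' := j'.2
              have h1 : (j' : ℕ) = j := by
                have := congrArg (· % k c) (show (j' : ℕ) + k c * l' = j + k c * (α' - p) by omega)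
                simpa [Nat.add_mul_mod_self_left, Nat.mod_eq_of_lt hj,
                  Nat.mod_eq_of_lt hj'] using this
              have h2 : (l' : ℕ) = α' - p :=
                Nat.eq_of_mul_eq_mul_left (show 0 < k c by omega) (by omega)
              refine hx ⟨⟨l', by omega⟩, ?_⟩
              obtain rfl : j' = j := Fin.ext h1
              obtain ⟨α', hα'⟩ := α'
              obtain ⟨l', hl'⟩ := l'
              simp only at h2 hp
              obtain rfl : α' = p + l' := by omega
              rfl
            · rw [(pencil_pow_apply _ _ _ _).1 (Or.inr (by simp only; omega)), mul_zero, coeff_zero,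
                mul_zero]
          · rw [armMonomial, if_neg hc, mul_zero, zero_mul, coeff_zero, mul_zero]
        · intro i
          rw [hinr, armMonomial, if_pos rfl, (pencil_pow_apply _ _ _ _).2 p i rfl rfl, hcoeff,
            if_pos (by simp only; omega), mul_assoc]
    have := congrFun key ⟨l, by omega⟩
    exact (mul_eq_zero.1 this).resolve_right (Nat.cast_add_one_ne_zero _)
  rintro (α | x)
  -- only the generators `Tr Y ^ (α + 1)` are left; the first column of `E ^ α` separates them
  · have h := hdir none α ⟨0, by have := α.2; omega⟩
    rw [Fintype.sum_sum_type] at h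
    simp only [hzero, zero_mul, Finset.sum_const_zero, add_zero, hinl, if_true, mul_one] at h
    have hE : ∀ (s : ℕ) (i q : Fin r), (shiftMatrix ℂ r ^ s) i q =
        if (i : ℕ) = q + s then 1 else 0 := by
      intro s i q
      have h := pencil_pow_apply (0 : ℂ) s i q
      rw [zero_smul, add_zero] at h
      split_ifs with hi
      · rw [h.2 s 0 (by omega) hi]
        simp [gaussBinom_zero_right]
      · by_cases h1 : (i : ℕ) < q ∨ (q : ℕ) + s < i
        · exact h.1 h1
        · rw [h.2 (i - q) (s + q - i) (by omega) (by omega), zero_pow (by omega)]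
          simp
    rw [Finset.sum_eq_single α] at h
    · rw [hE, if_pos (by simp)] at h
      simpa using (mul_eq_zero.1 h).resolve_right
        (by simpa using Nat.cast_add_one_ne_zero (R := ℂ) α.val)
    · intro α' _ hne
      rw [hE, if_neg, mul_zero, mul_zero]
      intro he
      exact hne (Fin.ext (by simpa using he.symm))
    · simp
  · exact hzero x

end Independence

/-! ### Transcendence degrees -/

section Trdeg

open Polynomial

variable {N r : ℕ} {κ : Type}

/-- The functions `Tr (B_c(x) ^ a)`, `1 ≤ a ≤ r`, for the arms `B_c(z) = ∑ i, b c i • X_i` and for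
`x` in a set `U c` of values of the spectral parameter. -/
def armValues (r : ℕ) (b : κ → Fin N → ℂ[X]) (U : κ → Set ℂ) : Set (Fun ℂ N r) :=
  {h | ∃ c, ∃ x ∈ U c, ∃ a ∈ Finset.Icc 1 r,
    h = ((∑ i, (b c i).eval x • site ℂ i : Matrix (Fin r) (Fin r) (Fun ℂ N r)) ^ a).trace}

theorem map_eval_trace_pow (b : Fin N → ℂ[X]) (x : ℂ) (a : ℕ) :
    MvPolynomial.map (evalRingHom x)
      ((∑ i, b i • site ℂ[X] i : Matrix (Fin r) (Fin r) (Fun ℂ[X] N r)) ^ a).trace =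
      ((∑ i, (b i).eval x • site ℂ i : Matrix (Fin r) (Fin r) (Fun ℂ N r)) ^ a).trace := by
  rw [map_trace_pow, map_matrix_sum]
  congr 2
  refine Finset.sum_congr rfl fun i _ => ?_
  rw [map_matrix_smul]
  congr 1
  ext p q : 2
  simp [site]

theorem map_eval_zero_eq_coeffwise {σ : Type*} (q : MvPolynomial σ ℂ[X]) :
    MvPolynomial.map (evalRingHom 0) q = coeffwise (lcoeff ℂ 0) q := by
  ext d
  simp [MvPolynomial.coeff_map, coeff_zero_eq_eval_zero]

/-- The values of the traces of powers of the arms generate the same algebra as the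
coefficients `gen`. -/
theorem adjoin_armValues [Nonempty κ] (k : κ → ℕ) (b : κ → Fin N → ℂ[X]) (y : Fin N → ℂ)
    (hdeg : ∀ c i, (b c i).natDegree ≤ k c) (hy : ∀ c i, (b c i).coeff 0 = y i)
    (U : κ → Set ℂ) (hU : ∀ c, (U c).Infinite) :
    Algebra.adjoin ℂ (armValues r b U) =
      Algebra.adjoin ℂ (Set.range (gen k b y : GenIndex r k → Fun ℂ N r)) := by
  have hY : ∀ c a, coeffwise (lcoeff ℂ 0)
      ((∑ i, b c i • site ℂ[X] i : Matrix (Fin r) (Fin r) (Fun ℂ[X] N r)) ^ a).trace =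
      ((∑ i, y i • site ℂ i : Matrix (Fin r) (Fin r) (Fun ℂ N r)) ^ a).trace := fun c a => by
    rw [← map_eval_zero_eq_coeffwise, map_eval_trace_pow]
    simp only [← coeff_zero_eq_eval_zero, hy]
  have hmem : ∀ c, ∀ a ∈ Finset.Icc 1 r, ∀ ρ : ℂ[X] →ₗ[ℂ] ℂ, coeffwise ρ
      ((∑ i, b c i • site ℂ[X] i : Matrix (Fin r) (Fin r) (Fun ℂ[X] N r)) ^ a).trace ∈
      Algebra.adjoin ℂ (armValues r b U) := fun c a ha ρ => by
    refine coeffwise_mem_of_infinite (Subalgebra.toSubmodule (Algebra.adjoin ℂ (armValues r b U)))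
      (hU c) (fun x hx => ?_) ρ
    rw [map_eval_trace_pow]
    exact Algebra.subset_adjoin ⟨c, x, hx, a, ha, rfl⟩
  refine le_antisymm (Algebra.adjoin_le ?_) (Algebra.adjoin_le ?_)
  · rintro _ ⟨c, x, hx, a, ha, rfl⟩
    have ha' := Finset.mem_Icc.1 ha
    rw [← map_eval_trace_pow, map_eval_eq_coeffwise]
    refine coeffwise_mem (degreeLT ℂ (a * k c + 1)) (fun d => ?_)
      (Subalgebra.toSubmodule (Algebra.adjoin ℂ (Set.range (gen k b y))))
      {τ | ∃ n ≤ a * k c, τ = lcoeff ℂ n} _ (fun n hn h => ?_) ?_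
    · rw [mem_degreeLT, Nat.cast_add, Nat.cast_one]
      refine (degree_le_of_natDegree_le (natDegree_coeff_trace_pow_le (a := k c)
        (fun p q d => ?_) a d)).trans_lt (by exact_mod_cast Nat.lt_succ_self _)
      rw [Matrix.sum_apply]
      refine natDegree_coeff_sum_le _ (fun i _ d => ?_) d
      classical
      rw [Matrix.smul_apply, MvPolynomial.coeff_smul, site, Matrix.of_apply,
        MvPolynomial.coeff_X, smul_eq_mul]
      split_ifs
      · rw [mul_one]
        exact hdeg c i
      · simp
    · have : n = 0 := by
        ext m
        by_cases hm : m ≤ a * k c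
        · exact h _ ⟨m, hm, rfl⟩
        · rw [coeff_zero]
          refine coeff_eq_zero_of_degree_lt ((mem_degreeLT.1 hn).trans_le ?_)
          exact_mod_cast Nat.lt_of_not_le hm
      rw [this, map_zero]
    · rintro _ ⟨n, hn, rfl⟩
      refine Algebra.subset_adjoin ?_
      rcases Nat.eq_zero_or_pos n with rfl | hn0
      · refine ⟨Sum.inl ⟨a - 1, by omega⟩, ?_⟩
        rw [hY, gen]
        congr 2
        simp only
        omega
      · have hk : 0 < k c := Nat.pos_of_ne_zero fun h0 => by
          rw [h0] at hn
          omega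
        have hl : (n - 1) / k c < a := by
          rw [Nat.div_lt_iff_lt_mul hk]
          omega
        refine ⟨Sum.inr (⟨c, ⟨(n - 1) % k c, Nat.mod_lt _ hk⟩⟩,
          ⟨⟨a - 1, by omega⟩, ⟨(n - 1) / k c, by simp only; omega⟩⟩), ?_⟩
        have h1 : 1 + (n - 1) % k c + k c * ((n - 1) / k c) = n := by
          have := Nat.mod_add_div (n - 1) (k c)
          omega
        have h2 : a - 1 + 1 = a := by omega
        simp only [gen, h1, h2]
  · rintro _ ⟨α | ⟨⟨c, j⟩, ⟨α, l⟩⟩, rfl⟩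
    · obtain ⟨c⟩ := ‹Nonempty κ›
      rw [gen, ← hY c]
      exact hmem c _ (Finset.mem_Icc.2 ⟨by omega, α.2⟩) _
    · exact hmem c _ (Finset.mem_Icc.2 ⟨by omega, α.2⟩) _

theorem trdeg_adjoin_range {ι A : Type} [CommRing A] [Algebra ℂ A] {x : ι → A}
    (hx : AlgebraicIndependent ℂ x) :
    Algebra.trdeg ℂ (Algebra.adjoin ℂ (Set.range x)) = Cardinal.mk ι := by
  rw [← hx.aevalEquiv.trdeg_eq, MvPolynomial.trdeg_of_isDomain, Cardinal.lift_id]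

variable [Fintype κ] [DecidableEq κ]

/-- The transcendence degree of the algebra generated by the traces of powers of arms
`B_c(z) = ∑ i, b c i • X_i` of degrees `k c` with a common constant term depends only on `r` and
`∑ c, k c`, provided that all coefficients of the arms are linearly independent combinations
of the matrices `X_i`, and as many as there are such matrices. -/
theorem trdeg_armValues [Nonempty κ] (k : κ → ℕ) (hN : N = ∑ c, k c + 1)
    (b : κ → Fin N → ℂ[X]) (y : Fin N → ℂ)
    (hdeg : ∀ c i, (b c i).natDegree ≤ k c) (hy : ∀ c i, (b c i).coeff 0 = y i)
    (hinj : ∀ v : Fin N → ℂ, (∀ c, ∑ i, v i • b c i = 0) → v = 0)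
    (U : κ → Set ℂ) (hU : ∀ c, (U c).Infinite) :
    Algebra.trdeg ℂ (Algebra.adjoin ℂ (armValues r b U)) =
      (r + (∑ c, k c) * Fintype.card (Σ α : Fin r, Fin (α.val + 1)) : ℕ) := by
  classical
  obtain ⟨c₀⟩ := ‹Nonempty κ›
  let P : Matrix (Option (Σ c, Fin (k c))) (Fin N) ℂ := Matrix.of fun t i =>
    match t with
    | none => y i
    | some ⟨c, j⟩ => (b c i).coeff (j.val + 1)
  have hP : Function.Injective P.mulVecLin := by
    rw [← LinearMap.ker_eq_bot, LinearMap.ker_eq_bot']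
    intro v hv
    refine hinj v fun c => ?_
    ext n
    rw [finsetSum_coeff, coeff_zero]
    simp only [coeff_smul, smul_eq_mul]
    rcases n with _ | n
    · simp only [hy]
      refine Eq.trans ?_ (congrFun hv none)
      exact Finset.sum_congr rfl fun i _ => mul_comm _ _
    · by_cases hn : n < k c
      · refine Eq.trans ?_ (congrFun hv (some ⟨c, ⟨n, hn⟩⟩))
        exact Finset.sum_congr rfl fun i _ => mul_comm _ _
      · refine Finset.sum_eq_zero fun i _ => ?_
        rw [coeff_eq_zero_of_natDegree_lt ((hdeg c i).trans_lt (by omega)), mul_zero]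
  have hsurj : Function.Surjective P.mulVecLin :=
    (LinearMap.injective_iff_surjective_of_finrank_eq_finrank (by simp [hN])).1 hP
  obtain ⟨T, hT⟩ := Matrix.mulVec_surjective_iff_exists_right_inverse.1 hsurj
  have hT' : ∀ s t, ∑ i, T i t * P s i = if s = t then 1 else 0 := fun s t => by
    rw [← Matrix.one_apply, ← hT, Matrix.mul_apply]
    exact Finset.sum_congr rfl fun i _ => mul_comm _ _
  have hind := algebraicIndependent_gen (r := r) k b y T
    (fun t => (hT' none t).trans (by simp only [eq_comm])) (fun c t => by
      ext n
      rw [finsetSum_coeff]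
      simp only [coeff_smul, smul_eq_mul]
      rcases n with _ | n
      · simp only [hy]
        have h := hT' none t
        rw [show ∑ i, T i t * y i = _ from h]
        rcases t with _ | ⟨c', j⟩
        · simp [armMonomial]
        · simp only [armMonomial]
          split_ifs <;> simp_all
      · by_cases hn : n < k c
        · have h := hT' (some ⟨c, ⟨n, hn⟩⟩) t
          rw [show ∑ i, T i t * (b c i).coeff (n + 1) = _ from h]
          rcases t with _ | ⟨c', j⟩
          · simp [armMonomial, coeff_one]
          · by_cases hc : c' = c
            · subst hc
              simp [armMonomial, coeff_X_pow, Fin.ext_iff]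
            · have hne : ¬ ((⟨c, ⟨n, hn⟩⟩ : Σ c, Fin (k c)) = ⟨c', j⟩) := fun h =>
                hc (congrArg Sigma.fst h).symm
              simp [armMonomial, hc, hne]
        · rw [Finset.sum_eq_zero fun i _ => by
            rw [coeff_eq_zero_of_natDegree_lt ((hdeg c i).trans_lt (by omega)), mul_zero]]
          rcases t with _ | ⟨c', j⟩
          · simp [armMonomial, coeff_one]
          · by_cases hc : c' = c
            · subst hc
              have := j.2
              simp only [armMonomial, if_true, coeff_X_pow]
              rw [if_neg (by omega)]
            · simp [armMonomial, hc])
  have : Nonempty κ := ⟨c₀⟩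
  rw [adjoin_armValues k b y hdeg hy U hU, trdeg_adjoin_range hind, Cardinal.mk_fintype]
  simp [GenIndex]

end Trdeg

/-! ### The limiting Lax matrices -/

section LaxForms

variable {N r k m : ℕ}

theorem site_map (i : Fin N) :
    (site ℂ i : Matrix (Fin r) (Fin r) (Fun ℂ N r)).map
      (MvPolynomial.map (algebraMap ℂ (RatFunc ℂ))) = site (RatFunc ℂ) i := by
  ext a b : 2
  simp [site]

theorem lax_eq_ratLax (ζ : Fin N → ℂ) :
    (lax ζ : Matrix (Fin r) (Fin r) (Fun (RatFunc ℂ) N r)) = ratLax ζ (site ℂ) := by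
  simp only [lax, ratLax, site_map]

theorem lax₁_eq_ratLax (u : Fin m → ℂ) :
    (lax₁ u : Matrix (Fin r) (Fin r) (Fun (RatFunc ℂ) (k + m) r)) =
      ratLax u fun j => site ℂ (Fin.natAdd k j) := by
  simp only [lax₁, ratLax, site_map]

/-- The nodes `z_1, …, z_k, w` of the second limiting Lax matrix. -/
def nodes₂ (z : Fin k → ℂ) (w : ℂ) : Option (Fin k) → ℂ := fun o => o.elim w z

/-- The matrix coefficients `X_1, …, X_k, X_{k+1} + ⋯ + X_N` of the second limiting Lax matrix. -/
noncomputable def coeffs₂ (k m r : ℕ) :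
    Option (Fin k) → Matrix (Fin r) (Fin r) (Fun ℂ (k + m) r) :=
  fun o => o.elim (∑ j, site ℂ (Fin.natAdd k j)) fun i => site ℂ (Fin.castAdd m i)

theorem lax₂_eq_ratLax (z : Fin k → ℂ) (w : ℂ) :
    (lax₂ z w : Matrix (Fin r) (Fin r) (Fun (RatFunc ℂ) (k + m) r)) =
      ratLax (nodes₂ z w) (coeffs₂ k m r) := by
  rw [lax₂, ratLax, Fintype.sum_option]
  refine (add_comm _ _).trans ?_
  simp only [nodes₂, coeffs₂, Option.elim, map_matrix_sum, site_map]

theorem range_nodes₂ (z : Fin k → ℂ) (w : ℂ) :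
    Set.range (nodes₂ z w) = insert w (Set.range z) := by
  ext x
  simp only [Set.mem_range, Option.exists, nodes₂, Option.elim, Set.mem_insert_iff]
  exact or_congr_left eq_comm

theorem nodes₂_injective {z : Fin k → ℂ} (hz : Function.Injective z) {w : ℂ}
    (hw : w ∉ Set.range z) : Function.Injective (nodes₂ z w) := by
  rintro (_ | i) (_ | j) h
  · rfl
  · exact absurd ⟨j, h.symm⟩ hw
  · exact absurd ⟨i, h⟩ hw
  · rw [hz h]

/-- The coefficient of `X_i` in the first limiting Lax matrix at the spectral parameter `x`. -/
noncomputable def weight₁ (u : Fin m → ℂ) (i : Fin (k + m)) (x : ℂ) : ℂ :=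
  Fin.addCases (fun _ => 0) (fun j => (x - u j)⁻¹) i

/-- The coefficient of `X_i` in the second limiting Lax matrix at the spectral parameter `x`. -/
noncomputable def weight₂ (z : Fin k → ℂ) (w : ℂ) (i : Fin (k + m)) (x : ℂ) : ℂ :=
  Fin.addCases (fun i => (x - z i)⁻¹) (fun _ => (x - w)⁻¹) i

theorem evalLax₁_eq (u : Fin m → ℂ) (x : ℂ) :
    evalLax u (fun j => (site ℂ (Fin.natAdd k j) : Matrix (Fin r) (Fin r) (Fun ℂ (k + m) r))) x =
      ∑ i, weight₁ u i x • site ℂ i := by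
  rw [Fin.sum_univ_add]
  simp [evalLax, weight₁]

theorem evalLax₂_eq (z : Fin k → ℂ) (w x : ℂ) :
    evalLax (nodes₂ z w) (coeffs₂ k m r) x = ∑ i, weight₂ z w i x • site ℂ i := by
  rw [Fin.sum_univ_add, evalLax, Fintype.sum_option]
  refine (add_comm _ _).trans ?_
  simp [nodes₂, coeffs₂, Finset.smul_sum, weight₂]

theorem infinite_compl_range {ι : Type*} [Finite ι] (ν : ι → ℂ) : (Set.range ν)ᶜ.Infinite :=
  (Set.finite_range ν).infinite_compl

end LaxForms

/-! ### Commutation -/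

section Commutation

variable {N r k m : ℕ}

theorem bracket_trace_pow_self (c : Fin N → ℂ) (a b : ℕ) :
    bracket ((∑ j, c j • site ℂ j : Matrix (Fin r) (Fin r) (Fun ℂ N r)) ^ a).trace
      ((∑ j, c j • site ℂ j : Matrix (Fin r) (Fin r) (Fun ℂ N r)) ^ b).trace = 0 := by
  rw [bracket]
  refine Finset.sum_eq_zero fun i _ => ?_
  rw [grad_trace_pow, grad_trace_pow]
  simp only [mul_smul_comm, smul_mul_assoc, ← smul_sub, Matrix.trace_smul]
  rw [mul_sub, Matrix.trace_sub, ← mul_assoc, Matrix.trace_mul_cycle, ← mul_assoc, ← pow_add,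
    ← pow_add, add_comm, sub_self, smul_zero, smul_zero]

/-- A Lax matrix whose weights satisfy the identity of `1 / (x - p)` Poisson-commutes with itself
at two values of the spectral parameter. -/
theorem bracket_trace_evalLax_pow (c : Fin N → ℂ → ℂ) {x y : ℂ}
    (h : ∀ i, c i x * c i y * (y - x) = c i x - c i y) (a b : ℕ) :
    bracket ((∑ j, c j x • site ℂ j : Matrix (Fin r) (Fin r) (Fun ℂ N r)) ^ a).trace
      ((∑ j, c j y • site ℂ j : Matrix (Fin r) (Fin r) (Fun ℂ N r)) ^ b).trace = 0 := by
  rcases eq_or_ne x y with rfl | hxy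
  · exact bracket_trace_pow_self _ a b
  · refine bracket_trace_pow_eq_zero _ _ (y - x)⁻¹ (-(y - x)⁻¹) (fun i => ?_) a b
    have h0 : y - x ≠ 0 := sub_ne_zero.2 hxy.symm
    rw [neg_mul, ← sub_eq_add_neg, ← mul_sub, ← h i]
    field_simp

theorem inv_sub_mul_inv_sub {x y p : ℂ} (hx : x ≠ p) (hy : y ≠ p) :
    (x - p)⁻¹ * (y - p)⁻¹ * (y - x) = (x - p)⁻¹ - (y - p)⁻¹ := by
  have h1 := sub_ne_zero.2 hx
  have h2 := sub_ne_zero.2 hy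
  field_simp
  ring

variable (z : Fin k → ℂ) (u : Fin m → ℂ) (w : ℂ)

/-- The values of the traces of powers of both limiting Lax matrices at regular points
Poisson-commute. -/
theorem bracket_traceValues {f g : Fun ℂ (k + m) r}
    (hf : f ∈ traceValues u (fun j => site ℂ (Fin.natAdd k j)) (Set.range u)ᶜ ∪
      traceValues (nodes₂ z w) (coeffs₂ k m r) (Set.range (nodes₂ z w))ᶜ)
    (hg : g ∈ traceValues u (fun j => site ℂ (Fin.natAdd k j)) (Set.range u)ᶜ ∪
      traceValues (nodes₂ z w) (coeffs₂ k m r) (Set.range (nodes₂ z w))ᶜ) :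
    bracket f g = 0 := by
  have hcross : ∀ x y : ℂ, ∀ a b : ℕ, bracket
      (evalLax u (fun j => (site ℂ (Fin.natAdd k j) :
        Matrix (Fin r) (Fin r) (Fun ℂ (k + m) r))) x ^ a).trace
      (evalLax (nodes₂ z w) (coeffs₂ k m r) y ^ b).trace = 0 := by
    intro x y a b
    rw [evalLax₁_eq, evalLax₂_eq]
    refine bracket_trace_pow_eq_zero _ _ (y - w)⁻¹ 0 (fun i => ?_) a b
    refine Fin.addCases (fun i => ?_) (fun j => ?_) i
    · simp [weight₁]
    · simp [weight₁, weight₂, mul_comm]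
  have hne : ∀ {p x : ℂ} {ι : Type} {ν : ι → ℂ} (i : ι), x ∈ (Set.range ν)ᶜ → ν i = p → x ≠ p := by
    rintro p x ι ν i hx rfl rfl
    exact hx ⟨i, rfl⟩
  rcases hf with ⟨x, hx, a, -, rfl⟩ | ⟨x, hx, a, -, rfl⟩ <;>
    rcases hg with ⟨y, hy, b, -, rfl⟩ | ⟨y, hy, b, -, rfl⟩
  · rw [evalLax₁_eq, evalLax₁_eq]
    refine bracket_trace_evalLax_pow (weight₁ u) (fun i => ?_) a b
    refine Fin.addCases (fun i => ?_) (fun j => ?_) i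
    · simp [weight₁]
    · simpa [weight₁] using inv_sub_mul_inv_sub (hne j hx rfl) (hne j hy rfl)
  · exact hcross x y a b
  · rw [bracket_skew, hcross, neg_zero]
  · rw [evalLax₂_eq, evalLax₂_eq]
    refine bracket_trace_evalLax_pow (weight₂ z w) (fun i => ?_) a b
    refine Fin.addCases (fun i => ?_) (fun j => ?_) i
    · simpa [weight₂, nodes₂] using inv_sub_mul_inv_sub (hne (some i) hx rfl) (hne (some i) hy rfl)
    · simpa [weight₂, nodes₂] using inv_sub_mul_inv_sub (hne none hx rfl) (hne none hy rfl)

theorem bracket_spec {f g : Fun ℂ (k + m) r} (hf : f ∈ spec₁ u ∪ spec₂ z w)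
    (hg : g ∈ spec₁ u ∪ spec₂ z w) : bracket f g = 0 := by
  have hsub : (spec₁ u ∪ spec₂ z w : Set (Fun ℂ (k + m) r)) ⊆
      Submodule.span ℂ (traceValues u (fun j => site ℂ (Fin.natAdd k j)) (Set.range u)ᶜ ∪
        traceValues (nodes₂ z w) (coeffs₂ k m r) (Set.range (nodes₂ z w))ᶜ) := by
    refine Set.union_subset ?_ ?_
    · rw [spec₁, lax₁_eq_ratLax]
      exact (spectralInvariants_subset_span u _ (infinite_compl_range u)
        (fun x hx i he => hx ⟨i, he.symm⟩) _).trans (Submodule.span_mono Set.subset_union_left)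
    · rw [spec₂, lax₂_eq_ratLax]
      exact (spectralInvariants_subset_span _ _ (infinite_compl_range _)
        (fun x hx i he => hx ⟨i, he.symm⟩) _).trans (Submodule.span_mono Set.subset_union_right)
  exact bracket_eq_zero_of_mem_span (fun f hf g hg => bracket_traceValues z u w hf hg)
    (hsub hf) (hsub hg)

end Commutation

/-! ### The transcendence degree of the Gaudin algebra -/

section TrdegLimit

open Polynomial

variable {N r k m : ℕ}

theorem adjoin_le_of_forall_smul {A : Type*} [CommRing A] [Algebra ℂ A] {s t : Set A}
    (h : ∀ f ∈ s, ∃ c : ℂ, ∃ g ∈ t, f = c • g) : Algebra.adjoin ℂ s ≤ Algebra.adjoin ℂ t := by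
  refine Algebra.adjoin_le fun f hf => ?_
  obtain ⟨c, g, hg, rfl⟩ := h f hf
  exact Subalgebra.smul_mem _ (Algebra.subset_adjoin hg) c

theorem prod_erase_ne_zero {ι : Type*} [Fintype ι] [DecidableEq ι] {ν : ι → ℂ}
    (hν : Function.Injective ν) (i : ι) : ∏ j ∈ Finset.univ.erase i, (ν i - ν j) ≠ 0 :=
  Finset.prod_ne_zero_iff.2 fun _ hj =>
    sub_ne_zero.2 fun h => Finset.ne_of_mem_erase hj (hν h).symm

/-- A combination of the Lagrange basis polynomials is determined by its value at the nodes. -/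
theorem eq_zero_of_sum_lagrange {ι : Type*} [Fintype ι] [DecidableEq ι] {ν : ι → ℂ}
    (hν : Function.Injective ν) (v : ι → ℂ)
    (h : ∀ i, ∑ j, v j * ∏ l ∈ Finset.univ.erase j, (ν i - ν l) = 0) : v = 0 := by
  funext i
  have h1 := h i
  rw [Finset.sum_eq_single i] at h1
  · exact (mul_eq_zero.1 h1).resolve_right (prod_erase_ne_zero hν i)
  · intro j _ hj
    rw [Finset.prod_eq_zero (Finset.mem_erase.2 ⟨hj.symm, Finset.mem_univ i⟩) (sub_self _),
      mul_zero]
  · simp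

theorem natDegree_prod_erase_le {ι : Type*} [Fintype ι] [DecidableEq ι] (p : ι → ℂ[X])
    (hp : ∀ i, (p i).natDegree ≤ 1) (i : ι) {d : ℕ} (hd : Fintype.card ι = d + 1) :
    (∏ j ∈ Finset.univ.erase i, p j).natDegree ≤ d := by
  refine (natDegree_prod_le _ _).trans ((Finset.sum_le_sum fun j _ => hp j).trans ?_)
  simp [hd]

theorem prod_erase_eq_mul_inv {ι : Type*} [Fintype ι] [DecidableEq ι] (f : ι → ℂ) {i : ι}
    (hi : f i ≠ 0) : ∏ j ∈ Finset.univ.erase i, f j = (∏ j, f j) * (f i)⁻¹ := by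
  rw [← Finset.mul_prod_erase _ f (Finset.mem_univ i)]
  field_simp

/-- The transcendence degree of the Gaudin algebra with `d + 1` sites. -/
theorem trdeg_spec {d : ℕ} (hN : N = d + 1) {ζ : Fin N → ℂ} (hζ : Function.Injective ζ) :
    Algebra.trdeg ℂ (Algebra.adjoin ℂ (spec ζ : Set (Fun ℂ N r))) =
      (r + d * Fintype.card (Σ α : Fin r, Fin (α.val + 1)) : ℕ) := by
  let b : Unit → Fin N → ℂ[X] := fun _ i => ∏ j ∈ Finset.univ.erase i, (X - C (ζ j))
  have hb : ∀ x ∈ (Set.range ζ)ᶜ, (∑ i, (b () i).eval x • site ℂ i :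
      Matrix (Fin r) (Fin r) (Fun ℂ N r)) = (∏ i, (x - ζ i)) • evalLax ζ (site ℂ) x := by
    intro x hx
    rw [evalLax, Finset.smul_sum]
    refine Finset.sum_congr rfl fun i _ => ?_
    rw [smul_smul, ← prod_erase_eq_mul_inv (fun i => x - ζ i)
      (sub_ne_zero.2 fun h => hx ⟨i, h.symm⟩)]
    simp [b, eval_prod]
  have h := trdeg_armValues (r := r) (fun _ : Unit => d) (by simpa using hN) b
    (fun i => (b () i).coeff 0)
    (fun _ i => natDegree_prod_erase_le _ (fun j => by simp) i (by simpa using hN))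
    (fun _ _ => rfl) (fun v hv => eq_zero_of_sum_lagrange hζ v fun i => by
      have := congrArg (eval (ζ i)) (hv ())
      simpa [b, eval_finsetSum, eval_prod] using this)
    (fun _ => (Set.range ζ)ᶜ) (fun _ => infinite_compl_range ζ)
  rw [Fintype.sum_unique] at h
  have hne : ∀ x ∈ (Set.range ζ)ᶜ, ∏ i, (x - ζ i) ≠ 0 := fun x hx =>
    Finset.prod_ne_zero_iff.2 fun i _ => sub_ne_zero.2 fun h => hx ⟨i, h.symm⟩
  have hadj : Algebra.adjoin ℂ (spec ζ : Set (Fun ℂ N r)) =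
      Algebra.adjoin ℂ (armValues r b fun _ => (Set.range ζ)ᶜ) := by
    rw [spec, lax_eq_ratLax, adjoin_spectralInvariants ζ _ hζ (infinite_compl_range ζ)
      (fun x hx i he => hx ⟨i, he.symm⟩)]
    refine le_antisymm (adjoin_le_of_forall_smul ?_) (adjoin_le_of_forall_smul ?_)
    · rintro _ ⟨x, hx, a, ha, rfl⟩
      refine ⟨((∏ i, (x - ζ i)) ^ a)⁻¹, _, ⟨(), x, hx, a, ha, rfl⟩, ?_⟩
      rw [hb x hx, trace_smul_pow, inv_smul_smul₀ (pow_ne_zero _ (hne x hx))]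
    · rintro _ ⟨⟨⟩, x, hx, a, ha, rfl⟩
      refine ⟨(∏ i, (x - ζ i)) ^ a, _, ⟨x, hx, a, ha, rfl⟩, ?_⟩
      rw [hb x hx, trace_smul_pow]
  rw [hadj, h]

end TrdegLimit

/-! ### The transcendence degree of the limit algebra -/

section LimitAlgebra

open Polynomial

variable {r k m : ℕ}

theorem limitAlgebra_eq_adjoin {z : Fin k → ℂ} {u : Fin m → ℂ} {w : ℂ}
    (hz : Function.Injective z) (hu : Function.Injective u) (hw : w ∉ Set.range z)
    {V₁ V₂ : Set ℂ} (hV₁ : V₁.Infinite) (hV₂ : V₂.Infinite) (h₁ : ∀ x ∈ V₁, ∀ j, x ≠ u j)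
    (h₂ : ∀ x ∈ V₂, ∀ o, x ≠ nodes₂ z w o) :
    (limitAlgebra z u w : Subalgebra ℂ (Fun ℂ (k + m) r)) =
      Algebra.adjoin ℂ (traceValues u (fun j => site ℂ (Fin.natAdd k j)) V₁ ∪
        traceValues (nodes₂ z w) (coeffs₂ k m r) V₂) := by
  rw [limitAlgebra, Algebra.adjoin_union, Algebra.adjoin_union, spec₁, spec₂, lax₁_eq_ratLax,
    lax₂_eq_ratLax, ← range_nodes₂, adjoin_spectralInvariants u _ hu hV₁ h₁,
    adjoin_spectralInvariants _ _ (nodes₂_injective hz hw) hV₂ h₂]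

/-- The coefficients of the two arms of the limiting Lax matrices. The arm `true` is
`s ∏ (s - (z_i - w)) L_2(w + s)`, and the arm `false` is `t⁻¹ ∏ (1 - (u_j - x₀) t) L_1(x₀ + t⁻¹)`,
normalised to have the same constant term, a multiple of `X_{k+1} + ⋯ + X_N`. -/
noncomputable def limitArm (z : Fin k → ℂ) (u : Fin m → ℂ) (w x₀ : ℂ) :
    Bool → Fin (k + m) → ℂ[X]
  | true => Fin.addCases (fun i => X * ∏ i' ∈ Finset.univ.erase i, (X - C (z i' - w)))
      (fun _ => ∏ i', (X - C (z i' - w)))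
  | false => Fin.addCases (fun _ => 0) (fun j => C (∏ i', (w - z i')) *
      ∏ j' ∈ Finset.univ.erase j, (1 - C (u j' - x₀) * X))

variable {z : Fin k → ℂ} {u : Fin m → ℂ} {w x₀ : ℂ}

/-- The arm `true` is a multiple of `L_2(w + s)`. -/
theorem sum_limitArm_true {s : ℂ} (hs : ∀ o, w + s ≠ nodes₂ z w o) :
    (∑ i, (limitArm z u w x₀ true i).eval s • site ℂ i :
      Matrix (Fin r) (Fin r) (Fun ℂ (k + m) r)) =
      (s * ∏ i, (s - (z i - w))) • evalLax (nodes₂ z w) (coeffs₂ k m r) (w + s) := by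
  rw [evalLax₂_eq, Finset.smul_sum]
  refine Finset.sum_congr rfl fun i _ => ?_
  rw [smul_smul]
  congr 1
  refine Fin.addCases (fun i => ?_) (fun j => ?_) i
  · have h : s - (z i - w) ≠ 0 := fun h => hs (some i) (by
      simp only [nodes₂, Option.elim]
      linear_combination h)
    have h' : w + s - z i = s - (z i - w) := by ring
    simp [limitArm, weight₂, eval_prod, prod_erase_eq_mul_inv (fun i => s - (z i - w)) h, h',
      mul_assoc]
  · have h : s ≠ 0 := fun h => hs none (by simp [nodes₂, h])
    simp [limitArm, weight₂, eval_prod]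
    field_simp

/-- The arm `false` is a multiple of `L_1(x₀ + t⁻¹)`. -/
theorem sum_limitArm_false {t : ℂ} (ht : t ≠ 0) (htu : ∀ j, x₀ + t⁻¹ ≠ u j) :
    (∑ i, (limitArm z u w x₀ false i).eval t • site ℂ i :
      Matrix (Fin r) (Fin r) (Fun ℂ (k + m) r)) =
      ((∏ i, (w - z i)) * (∏ j, (1 - (u j - x₀) * t)) * t⁻¹) •
        evalLax u (fun j => site ℂ (Fin.natAdd k j)) (x₀ + t⁻¹) := by
  rw [evalLax₁_eq, Finset.smul_sum]
  refine Finset.sum_congr rfl fun i _ => ?_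
  rw [smul_smul]
  congr 1
  refine Fin.addCases (fun i => ?_) (fun j => ?_) i
  · simp [limitArm, weight₁]
  · have h' : x₀ + t⁻¹ - u j = (1 - (u j - x₀) * t) * t⁻¹ := by
      field_simp
      ring
    have h : 1 - (u j - x₀) * t ≠ 0 := fun h => htu j (by
      rw [h, zero_mul] at h'
      exact sub_eq_zero.1 h')
    simp only [limitArm, weight₁, Fin.addCases_right, eval_mul, eval_C, eval_prod, eval_sub,
      eval_one, eval_X, h', prod_erase_eq_mul_inv (fun j => 1 - (u j - x₀) * t) h]
    generalize 1 - (u j - x₀) * t = f at h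
    generalize ∏ l, (1 - (u l - x₀) * t) = Q
    field_simp

theorem natDegree_limitArm_le {m : ℕ} {u : Fin (m + 1) → ℂ} (c : Bool) (i : Fin (k + (m + 1))) :
    (limitArm z u w x₀ c i).natDegree ≤ cond c k m := by
  have h1 : ∀ e : ℂ, (1 - C e * X : ℂ[X]).natDegree ≤ 1 := fun e => by
    exact (natDegree_sub_le _ _).trans
      (max_le (by simp) ((natDegree_C_mul_le _ _).trans natDegree_X_le))
  refine Fin.addCases (fun i => ?_) (fun j => ?_) i <;> cases c
  · simp [limitArm]
  · simp only [limitArm, Fin.addCases_left, cond_true]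
    obtain ⟨d, rfl⟩ : ∃ d, k = d + 1 := ⟨k - 1, by have := i.2; omega⟩
    refine (natDegree_mul_le_of_le natDegree_X_le (natDegree_prod_erase_le (d := d) _
      (fun j => (natDegree_X_sub_C _).le) i (by simp))).trans (by omega)
  · simp only [limitArm, Fin.addCases_right, cond_false]
    exact (natDegree_C_mul_le _ _).trans
      (natDegree_prod_erase_le _ (fun j => h1 _) j (by simp))
  · simp only [limitArm, Fin.addCases_right, cond_true]
    exact (natDegree_prod_le _ _).trans
      ((Finset.sum_le_sum fun _ _ => (natDegree_X_sub_C _).le).trans (by simp))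

theorem coeff_zero_limitArm (c : Bool) (i : Fin (k + m)) :
    (limitArm z u w x₀ c i).coeff 0 = (limitArm z u w x₀ true i).coeff 0 := by
  cases c
  · simp only [coeff_zero_eq_eval_zero]
    refine Fin.addCases (fun i => ?_) (fun j => ?_) i
    · simp [limitArm]
    · simp [limitArm, eval_prod]
  · rfl

/-- The limiting arms determine all residues. -/
theorem eq_zero_of_sum_limitArm (hz : Function.Injective z) (hu : Function.Injective u)
    (hw : w ∉ Set.range z) (hx₀ : x₀ ∉ Set.range u) (v : Fin (k + m) → ℂ)
    (h : ∀ c, ∑ i, v i • limitArm z u w x₀ c i = 0) : v = 0 := by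
  have hwz : ∀ i, w - z i ≠ 0 := fun i h => hw ⟨i, (sub_eq_zero.1 h).symm⟩
  have he : ∀ j, u j - x₀ ≠ 0 := fun j h => hx₀ ⟨j, sub_eq_zero.1 h⟩
  have h1 : (fun j => v (Fin.natAdd k j) * ∏ i, (w - z i)) = 0 := by
    have hinj : Function.Injective fun j => (u j - x₀)⁻¹ :=
      inv_injective.comp ((sub_left_injective).comp hu)
    have hconst : ∀ j, (∏ l ∈ Finset.univ.erase j, (u l - x₀)) ≠ 0 := fun j =>
      Finset.prod_ne_zero_iff.2 fun l _ => he l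
    -- `1 - e_l t = -e_l (t - e_l⁻¹)` turns the products into Lagrange basis polynomials
    have h2 := eq_zero_of_sum_lagrange hinj (fun j => v (Fin.natAdd k j) * (∏ i, (w - z i)) *
        ∏ l ∈ Finset.univ.erase j, -(u l - x₀)) fun i => by
      have h3 := congrArg (eval (u i - x₀)⁻¹) (h false)
      rw [Fin.sum_univ_add] at h3
      simp only [limitArm, Fin.addCases_left, Fin.addCases_right, smul_zero, Finset.sum_const_zero,
        zero_add, eval_finsetSum, eval_smul, eval_mul, eval_C, eval_prod, eval_sub, eval_one,
        eval_X, eval_zero, smul_eq_mul] at h3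
      rw [← h3]
      refine Finset.sum_congr rfl fun j _ => ?_
      rw [mul_assoc, mul_assoc, ← Finset.prod_mul_distrib]
      congr 2
      refine Finset.prod_congr rfl fun l _ => ?_
      rw [neg_mul, mul_sub, mul_inv_cancel₀ (he l)]
      ring
    funext j
    refine (mul_eq_zero.1 (congrFun h2 j)).resolve_right ?_
    exact Finset.prod_ne_zero_iff.2 fun l _ => neg_ne_zero.2 (he l)
  have h4 : ∀ j, v (Fin.natAdd k j) = 0 := fun j =>
    (mul_eq_zero.1 (congrFun h1 j)).resolve_right (Finset.prod_ne_zero_iff.2 fun i _ => hwz i)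
  have h5 : (fun i => v (Fin.castAdd m i)) = 0 := by
    have hinj : Function.Injective fun i => z i - w := sub_left_injective.comp hz
    refine eq_zero_of_sum_lagrange hinj _ fun i => ?_
    have h3 := congrArg (eval (z i - w)) (h true)
    rw [Fin.sum_univ_add] at h3
    simp only [limitArm, Fin.addCases_left, Fin.addCases_right, h4, zero_smul,
      Finset.sum_const_zero, add_zero, eval_finsetSum, eval_smul, eval_mul, eval_C, eval_prod,
      eval_sub, eval_X, eval_zero, smul_eq_mul] at h3
    have h6 : z i - w ≠ 0 := fun h => hwz i (by linear_combination -h)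
    refine (mul_eq_zero.1 ?_).resolve_left h6
    rw [← h3, Finset.mul_sum]
    refine Finset.sum_congr rfl fun j _ => by ring
  funext i
  exact Fin.addCases (fun i => congrFun h5 i) (fun j => h4 j) i

/-- The transcendence degree of the limit algebra, for at least one site `i > k`. -/
theorem trdeg_limitAlgebra {m : ℕ} {u : Fin (m + 1) → ℂ} (hz : Function.Injective z)
    (hu : Function.Injective u) (hw : w ∉ Set.range z) :
    Algebra.trdeg ℂ (limitAlgebra z u w : Subalgebra ℂ (Fun ℂ (k + (m + 1)) r)) =
      (r + (k + m) * Fintype.card (Σ α : Fin r, Fin (α.val + 1)) : ℕ) := by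
  -- centring `t⁻¹ = x - x₀` away from the `u_j` makes every factor `1 - (u_j - x₀) t`
  -- have degree one
  obtain ⟨x₀, hx₀⟩ := (infinite_compl_range u).nonempty
  have hV₁ : (insert x₀ (Set.range u))ᶜ.Infinite :=
    ((Set.finite_range u).insert x₀).infinite_compl
  have hV₂ : (Set.range (nodes₂ z w))ᶜ.Infinite := infinite_compl_range _
  let U : Bool → Set ℂ := fun c => cond c {s | w + s ∈ (Set.range (nodes₂ z w))ᶜ}
    {t | t ≠ 0 ∧ x₀ + t⁻¹ ∈ (insert x₀ (Set.range u))ᶜ}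
  have hU : ∀ c, (U c).Infinite := by
    rintro (_ | _)
    · refine (hV₁.image ((inv_injective.comp (sub_left_injective (b := x₀))).injOn)).mono ?_
      rintro _ ⟨x, hx, rfl⟩
      have hx' : x - x₀ ≠ 0 := fun h => hx (Or.inl (sub_eq_zero.1 h))
      refine ⟨inv_ne_zero hx', ?_⟩
      simpa using hx
    · refine (hV₂.image ((sub_left_injective (b := w)).injOn)).mono ?_
      rintro _ ⟨x, hx, rfl⟩
      simpa [U] using hx
  have h := trdeg_armValues (r := r) (fun c => cond c k m)
    (by rw [Fintype.sum_bool]; simp only [cond_true, cond_false]; omega)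
    (limitArm z u w x₀) (fun i => (limitArm z u w x₀ true i).coeff 0) natDegree_limitArm_le
    coeff_zero_limitArm (eq_zero_of_sum_limitArm hz hu hw hx₀) U hU
  rw [Fintype.sum_bool] at h
  simp only [cond_true, cond_false] at h
  have h₁ : ∀ x ∈ (insert x₀ (Set.range u))ᶜ, ∀ j, x ≠ u j := fun x hx j hj =>
    hx (Or.inr ⟨j, hj.symm⟩)
  have h₂ : ∀ x ∈ (Set.range (nodes₂ z w))ᶜ, ∀ o, x ≠ nodes₂ z w o := fun x hx o ho =>
    hx ⟨o, ho.symm⟩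
  have hadj : (limitAlgebra z u w : Subalgebra ℂ (Fun ℂ (k + (m + 1)) r)) =
      Algebra.adjoin ℂ (armValues r (limitArm z u w x₀) U) := by
    rw [limitAlgebra_eq_adjoin hz hu hw hV₁ hV₂ h₁ h₂]
    refine le_antisymm (adjoin_le_of_forall_smul ?_) (adjoin_le_of_forall_smul ?_)
    · rintro _ (⟨x, hx, a, ha, rfl⟩ | ⟨x, hx, a, ha, rfl⟩)
      · have hx' : x - x₀ ≠ 0 := fun h => hx (Or.inl (sub_eq_zero.1 h))
        have hxx : x₀ + (x - x₀)⁻¹⁻¹ = x := by simp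
        have hs := sum_limitArm_false (r := r) (z := z) (u := u) (w := w) (inv_ne_zero hx')
          (fun j => by rw [hxx]; exact h₁ x hx j)
        rw [hxx] at hs
        have hne : (∏ i, (w - z i)) * (∏ j, (1 - (u j - x₀) * (x - x₀)⁻¹)) * (x - x₀)⁻¹⁻¹ ≠ 0 := by
          refine mul_ne_zero (mul_ne_zero (Finset.prod_ne_zero_iff.2 fun i _ h =>
            hw ⟨i, (sub_eq_zero.1 h).symm⟩) (Finset.prod_ne_zero_iff.2 fun j _ h => ?_))
            (inv_ne_zero (inv_ne_zero hx'))
          refine h₁ x hx j ?_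
          field_simp at h
          linear_combination h
        refine ⟨(((∏ i, (w - z i)) * (∏ j, (1 - (u j - x₀) * (x - x₀)⁻¹)) *
          (x - x₀)⁻¹⁻¹) ^ a)⁻¹, _,
          ⟨false, (x - x₀)⁻¹, ⟨inv_ne_zero hx', by rwa [hxx]⟩, a, ha, rfl⟩, ?_⟩
        rw [hs, trace_smul_pow, inv_smul_smul₀ (pow_ne_zero _ hne)]
      · have hxx : w + (x - w) = x := by ring
        have hs := sum_limitArm_true (r := r) (z := z) (u := u) (w := w) (x₀ := x₀) (s := x - w)
          (fun o => by rw [hxx]; exact h₂ x hx o)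
        rw [hxx] at hs
        have hne : (x - w) * ∏ i, (x - w - (z i - w)) ≠ 0 := by
          refine mul_ne_zero (sub_ne_zero.2 (h₂ x hx none)) (Finset.prod_ne_zero_iff.2 fun i _ h =>
            h₂ x hx (some i) ?_)
          simp only [nodes₂, Option.elim]
          linear_combination h
        refine ⟨(((x - w) * ∏ i, (x - w - (z i - w))) ^ a)⁻¹, _,
          ⟨true, x - w, show w + (x - w) ∈ _ by rwa [hxx], a, ha, rfl⟩, ?_⟩
        rw [hs, trace_smul_pow, inv_smul_smul₀ (pow_ne_zero _ hne)]
    · rintro _ ⟨_ | _, x, hx, a, ha, rfl⟩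
      · exact ⟨_, _, Or.inl ⟨x₀ + x⁻¹, hx.2, a, ha, rfl⟩, by
          rw [sum_limitArm_false hx.1 (h₁ _ hx.2), trace_smul_pow]⟩
      · exact ⟨_, _, Or.inr ⟨w + x, hx, a, ha, rfl⟩, by
          rw [sum_limitArm_true (h₂ _ hx), trace_smul_pow]⟩
  rw [hadj, h]

/-- Without sites `i > k` the limit algebra is a Gaudin algebra. -/
theorem limitAlgebra_eq_adjoin_spec {u : Fin 0 → ℂ} (hz : Function.Injective z)
    (hw : w ∉ Set.range z) :
    (limitAlgebra z u w : Subalgebra ℂ (Fun ℂ (k + 0) r)) =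
      Algebra.adjoin ℂ (spec (N := k + 0) z) := by
  have h₂ : ∀ x ∈ (Set.range (nodes₂ z w))ᶜ, ∀ o, x ≠ nodes₂ z w o := fun x hx o ho =>
    hx ⟨o, ho.symm⟩
  rw [limitAlgebra_eq_adjoin (V₁ := Set.univ) hz (fun i => i.elim0) hw Set.infinite_univ
    (infinite_compl_range (nodes₂ z w)) (fun _ _ j => j.elim0) h₂, spec, lax_eq_ratLax,
    adjoin_spectralInvariants z _ hz (infinite_compl_range (nodes₂ z w))
      (fun x hx i => h₂ x hx (some i))]
  have h : ∀ x, evalLax (nodes₂ z w) (coeffs₂ k 0 r) x = evalLax (N := k + 0) z (site ℂ) x :=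
    fun x => by
      rw [evalLax, evalLax, Fintype.sum_option]
      simp [coeffs₂, nodes₂]
  refine le_antisymm (Algebra.adjoin_le ?_) (adjoin_le_of_forall_smul ?_)
  · rintro _ (⟨x, hx, a, ha, rfl⟩ | ⟨x, hx, a, ha, rfl⟩)
    · rw [evalLax, Finset.univ_eq_empty, Finset.sum_empty,
        zero_pow (Nat.one_le_iff_ne_zero.1 (Finset.mem_Icc.1 ha).1), Matrix.trace_zero]
      exact zero_mem _
    · rw [h]
      exact Algebra.subset_adjoin ⟨x, hx, a, ha, rfl⟩
  · rintro _ ⟨x, hx, a, ha, rfl⟩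
    exact ⟨1, _, Or.inr ⟨x, hx, a, ha, rfl⟩, by rw [h, one_smul]⟩

end LimitAlgebra

/-! ### The physical Hamiltonian -/

section Hamiltonian

open Polynomial

variable {N r : ℕ}

/-- For `r ≤ 1` the exponent `2` is not among the exponents `1, …, r`, but the trace is then `0`
or a single matrix entry. -/
theorem trace_sq_mem {S : Type*} [CommRing S] [Algebra ℂ S] (A : Subalgebra ℂ S)
    (M : Matrix (Fin r) (Fin r) S) (h : ∀ a ∈ Finset.Icc 1 r, (M ^ a).trace ∈ A) :
    (M ^ 2).trace ∈ A := by
  match r with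
  | 0 => simp [Matrix.trace]
  | 1 =>
    have h1 := A.pow_mem (h 1 (by simp)) 2
    simpa [Matrix.trace, pow_two, Matrix.mul_apply] using h1
  | r + 2 => exact h 2 (by simp)

variable {ι : Type*} [Fintype ι] [DecidableEq ι] {ν : ι → ℂ}
  (Y : ι → Matrix (Fin r) (Fin r) (Fun ℂ N r))

/-- An algebra that contains the traces of powers of `L(x)` at infinitely many regular points
contains `Tr (Y_i ^ 2)` for each residue `Y_i`, by evaluating the numerator at the node. -/
theorem trace_coeff_sq_mem (hν : Function.Injective ν) (A : Subalgebra ℂ (Fun ℂ N r)) {U : Set ℂ}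
    (hU : U.Infinite) (hUν : ∀ x ∈ U, ∀ i, x ≠ ν i) (hA : traceValues ν Y U ⊆ A) (i : ι) :
    (Y i ^ 2).trace ∈ A := by
  have h := coeffwise_trace_clearedLax_mem ν Y (Subalgebra.toSubmodule A) hU hUν 2
    (fun x hx => trace_sq_mem A _ fun a ha => hA ⟨x, hx, a, ha, rfl⟩) (aeval (ν i)).toLinearMap
  have h1 : (clearedLax ν Y).map (MvPolynomial.map (evalRingHom (ν i))) =
      (∏ j ∈ Finset.univ.erase i, (ν i - ν j)) • Y i := by
    rw [clearedLax, map_matrix_sum, Finset.sum_eq_single i]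
    · rw [map_matrix_smul, map_map_eval_C]
      simp
    · intro j _ hj
      rw [map_matrix_smul, coe_evalRingHom, eval_prod,
        Finset.prod_eq_zero (Finset.mem_erase.2 ⟨hj.symm, Finset.mem_univ i⟩) (by simp), zero_smul]
    · simp
  rw [← map_eval_eq_coeffwise, map_trace_pow, h1, trace_smul_pow] at h
  have h2 := A.smul_mem h ((∏ j ∈ Finset.univ.erase i, (ν i - ν j)) ^ 2)⁻¹
  rwa [inv_smul_smul₀ (pow_ne_zero _ (prod_erase_ne_zero hν i))] at h2

/-- An algebra that contains the traces of powers of `L(x)` at infinitely many regular points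
contains `Tr ((∑ i, Y_i) ^ 2)`, by letting `x` tend to infinity. -/
theorem trace_sum_coeff_sq_mem (A : Subalgebra ℂ (Fun ℂ N r)) {U : Set ℂ}
    (hU : U.Infinite) (hUν : ∀ x ∈ U, ∀ i, x ≠ ν i) (hA : traceValues ν Y U ⊆ A) :
    ((∑ i, Y i) ^ 2).trace ∈ A := by
  let M : Matrix (Fin r) (Fin r) (MvPolynomial (Fin N × Fin r × Fin r) ℂ[X]) :=
    ∑ i, (∏ j ∈ Finset.univ.erase i, (1 - C (ν j) * X)) • (Y i).map (MvPolynomial.map C)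
  have hM : ∀ t, M.map (MvPolynomial.map (evalRingHom t)) =
      ∑ i, (∏ j ∈ Finset.univ.erase i, (1 - ν j * t)) • Y i := fun t => by
    rw [map_matrix_sum]
    refine Finset.sum_congr rfl fun i _ => ?_
    rw [map_matrix_smul, map_map_eval_C]
    simp
  have h := coeffwise_mem_of_infinite (q := (M ^ 2).trace) (Subalgebra.toSubmodule A)
    (U := (fun x => x⁻¹) '' (U \ {0})) ((hU.sdiff (Set.finite_singleton 0)).image
      inv_injective.injOn) ?_ (aeval 0).toLinearMap
  · rw [← map_eval_eq_coeffwise, map_trace_pow, hM] at h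
    simpa using h
  · rintro _ ⟨x, ⟨hx, hx0 : x ≠ 0⟩, rfl⟩
    have h1 : M.map (MvPolynomial.map (evalRingHom x⁻¹)) =
        ((∏ j, (1 - ν j * x⁻¹)) * x) • evalLax ν Y x := by
      rw [hM, evalLax, Finset.smul_sum]
      refine Finset.sum_congr rfl fun i _ => ?_
      have h2 : 1 - ν i * x⁻¹ = (x - ν i) * x⁻¹ := by field_simp
      have h3 : 1 - ν i * x⁻¹ ≠ 0 := by
        rw [h2]
        exact mul_ne_zero (sub_ne_zero.2 (hUν x hx i)) (inv_ne_zero hx0)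
      rw [smul_smul, prod_erase_eq_mul_inv (fun j => 1 - ν j * x⁻¹) h3, h2, mul_inv, inv_inv]
      congr 1
      ring
    rw [map_trace_pow, h1, trace_smul_pow]
    exact A.smul_mem (trace_sq_mem A _ fun a ha => hA ⟨x, hx, a, ha, rfl⟩) _

theorem physicalHamiltonian_eq : physicalHamiltonian N r =
    (1 / 2 : ℂ) • (((∑ i, site ℂ i : Matrix (Fin r) (Fin r) (Fun ℂ N r)) ^ 2).trace -
      ∑ i, ((site ℂ i : Matrix (Fin r) (Fin r) (Fun ℂ N r)) ^ 2).trace) := by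
  rw [physicalHamiltonian, pow_two, Finset.sum_mul, Matrix.trace_sum, ← Finset.sum_sub_distrib]
  congr 1
  refine Finset.sum_congr rfl fun i _ => ?_
  rw [Finset.mul_sum, Matrix.trace_sum, ← Finset.add_sum_erase _ _ (Finset.mem_univ i), pow_two,
    add_sub_cancel_left]

theorem physicalHamiltonian_mem {k m : ℕ} {z : Fin k → ℂ} {u : Fin m → ℂ} {w : ℂ}
    (hz : Function.Injective z) (hu : Function.Injective u) (hw : w ∉ Set.range z) :
    physicalHamiltonian (k + m) r ∈ limitAlgebra z u w := by
  have hu' := infinite_compl_range u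
  have hz' := infinite_compl_range (nodes₂ z w)
  have h₁ : ∀ x ∈ (Set.range u)ᶜ, ∀ j, x ≠ u j := fun x hx j hj => hx ⟨j, hj.symm⟩
  have h₂ : ∀ x ∈ (Set.range (nodes₂ z w))ᶜ, ∀ o, x ≠ nodes₂ z w o := fun x hx o ho =>
    hx ⟨o, ho.symm⟩
  rw [limitAlgebra_eq_adjoin hz hu hw hu' hz' h₁ h₂, physicalHamiltonian_eq]
  have hA₁ := Set.subset_union_left.trans (Algebra.subset_adjoin (R := ℂ)
    (s := traceValues u (fun j => (site ℂ (Fin.natAdd k j) :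
      Matrix (Fin r) (Fin r) (Fun ℂ (k + m) r))) (Set.range u)ᶜ ∪
        traceValues (nodes₂ z w) (coeffs₂ k m r) (Set.range (nodes₂ z w))ᶜ))
  have hA₂ := Set.subset_union_right.trans (Algebra.subset_adjoin (R := ℂ)
    (s := traceValues u (fun j => (site ℂ (Fin.natAdd k j) :
      Matrix (Fin r) (Fin r) (Fun ℂ (k + m) r))) (Set.range u)ᶜ ∪
        traceValues (nodes₂ z w) (coeffs₂ k m r) (Set.range (nodes₂ z w))ᶜ))
  have hsum : (∑ o, coeffs₂ k m r o) = ∑ i, site ℂ i := by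
    rw [Fintype.sum_option, Fin.sum_univ_add]
    exact add_comm _ _
  refine Subalgebra.smul_mem _ (Subalgebra.sub_mem _ ?_ (Subalgebra.sum_mem _ fun i _ => ?_)) _
  · rw [← hsum]
    exact trace_sum_coeff_sq_mem _ _ hz' h₂ hA₂
  · refine Fin.addCases (fun i => ?_) (fun j => ?_) i
    · exact trace_coeff_sq_mem _ (nodes₂_injective hz hw) _ hz' h₂ hA₂ (some i)
    · exact trace_coeff_sq_mem _ hu _ hu' h₁ hA₁ j

end Hamiltonian

end Gaudin

theorem proposition1 (r k m : ℕ) (z : Fin k → ℂ) (u : Fin m → ℂ)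
    (hz : Function.Injective z) (hu : Function.Injective u) (w : ℂ) :
    (∀ f ∈ (Gaudin.spec₁ u ∪ Gaudin.spec₂ z w : Set (Gaudin.Fun ℂ (k + m) r)),
      ∀ g ∈ (Gaudin.spec₁ u ∪ Gaudin.spec₂ z w : Set (Gaudin.Fun ℂ (k + m) r)),
        Gaudin.bracket f g = 0) ∧
    (∀ f ∈ (Gaudin.limitAlgebra z u w : Subalgebra ℂ (Gaudin.Fun ℂ (k + m) r)),
      ∀ g ∈ (Gaudin.limitAlgebra z u w : Subalgebra ℂ (Gaudin.Fun ℂ (k + m) r)),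
        Gaudin.bracket f g = 0) ∧
    (w ∉ Set.range z →
      (∀ ζ : Fin (k + m) → ℂ, Function.Injective ζ →
        Algebra.trdeg ℂ (Gaudin.limitAlgebra z u w : Subalgebra ℂ (Gaudin.Fun ℂ (k + m) r)) =
          Algebra.trdeg ℂ (Algebra.adjoin ℂ (Gaudin.spec ζ : Set (Gaudin.Fun ℂ (k + m) r)))) ∧
      Gaudin.physicalHamiltonian (k + m) r ∈ Gaudin.limitAlgebra z u w) := by
  refine ⟨fun f hf g hg => Gaudin.bracket_spec z u w hf hg, fun f hf g hg =>
    Gaudin.bracket_eq_zero_of_mem_adjoin (fun f hf g hg => Gaudin.bracket_spec z u w hf hg) hf hg,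
    fun hw => ⟨fun ζ hζ => ?_, Gaudin.physicalHamiltonian_mem hz hu hw⟩⟩
  -- without sites `i > k` the arm of `L_1` does not exist
  rcases m with _ | m
  · rw [Gaudin.limitAlgebra_eq_adjoin_spec hz hw]
    rcases k with _ | k
    · rw [show ζ = z from funext fun i => i.elim0]
    · rw [Gaudin.trdeg_spec (N := k + 1) rfl hz, Gaudin.trdeg_spec (N := k + 1) rfl hζ]
  · rw [Gaudin.trdeg_limitAlgebra hz hu hw, Gaudin.trdeg_spec (d := k + m) (by omega) hζ]
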